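/- Let $G = N \rtimes H$ be a semidirect product of (discrete) groups and let $M$ be a normal subgroup of $N$. For $a \in H$ let $M_a := aMa^{-1} \subseteq N$, and let $P := \{a \in H : aMa^{-1} \subseteq M\}$. Assume that $H = PP^{-1} = P^{-1}P$, that $M_a$ has finite index in $M$ for every $a \in P$, and that $\bigcap_{a \in P} M_a = \{e\}$. Let $\overline{N} := \varprojlim_{a \in H} N/M_a$ be the completion of $N$ with respect to the group topology with neighbourhood base $\{aMa^{-1}\}_{a \in H}$ at the identity (the inverse limit of the discrete groups $N/M_a$ along the quotient maps $N/M_a \to N/M_b$ for $M_a \subseteq M_b$), and let $\overline{M}$ be the closure of $M$ in $\overline{N}$. The group $G$ acts on $\overline{N}$ from the left, $N$ by left translation and $H$ by the continuous extension of conjugation, and from the right by $x.g := g^{-1}x$. Let $\mathcal{G} := \overline{N} \rtimes G|_{\overline{M}}$ be the restriction to $\overline{M}$ of the transformation groupoid of the right action, with $G$ discrete: its arrows are the pairs $(x,g) \in \overline{N} \times G$ with $x \in \overline{M}$ and $x.g \in \overline{M}$, with the subspace topology, $r(x,g) = x$, $s(x,g) = x.g$, $(x,g)(x.g,g') = (x,gg')$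 and $(x,g)^{-1} = (x.g, g^{-1})$. For $x \in \overline{M}$ put $\mathcal{G}^{(x)} := r^{-1}(x)$ and let $\pi_x$ be the representation of the convolution $*$-algebra $C_c(\mathcal{G})$ on $\ell^2(\mathcal{G}^{(x)})$ with $\pi_x(f)\delta_\gamma = \sum_{\alpha \in \mathcal{G}^{(x)}} f(\alpha^{-1}\gamma)\delta_\alpha$. The reduced $C^*$-algebra $C^*_{red}(\mathcal{G})$ is the completion of $C_c(\mathcal{G})$ in the norm $\|f\|_{red} = \sup_{x \in \overline{M}} \|\pi_x(f)\|$. On $\ell^2(M) \otimes \ell^2(H) = \ell^2(M \times H)$ consider, for $a \in P$ and $m \in M$, the isometry $S_a(\delta_n \otimes \delta_b) := \delta_{ana^{-1}} \otimes \delta_{ab}$ and the unitary $U(m)(\delta_n \otimes \delta_b) := \delta_{mn} \otimes \delta_b$, and let $\mathfrak{A}_r[N \rtimes H, M]$ be the $C^*$-algebra of operators generated by $\{S_a : a \in P\} \cup \{U(m) : m \in M\}$. Then $C^*_{red}(\mathcal{G})$ and $\mathfrak{A}_r[N \rtimes H, M]$ are isomorphic as $C^*$-algebras. -/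

import Mathlib

noncomputable section

namespace CuntzLi

open CategoryTheory

/-! ### Operators on `ℓ²` given by matrices -/

/-- The Hilbert space `ℓ²(ι)` of square summable complex families indexed by `ι`. -/
abbrev Ell2 (ι : Type*) : Type _ := lp (fun _ : ι => ℂ) 2

/-- The canonical orthonormal basis `(δ_i)` of `ℓ²(ι)`. -/
def stdBasis (ι : Type*) : HilbertBasis ι ℂ (Ell2 ι) :=
  HilbertBasis.ofRepr (LinearIsometryEquiv.refl ℂ (Ell2 ι))

/-- The isometry `ℓ²(ι) → ℓ²(κ)`, `δ_i ↦ δ_{f i}`, attached to an injection `f : ι → κ`. -/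
def pushIsometry {ι κ : Type*} (f : ι → κ) (hf : Function.Injective f) :
    Ell2 ι →ₗᵢ[ℂ] Ell2 κ :=
  (((stdBasis κ).orthonormal.comp f hf).orthogonalFamily).linearIsometry

theorem pushIsometry_stdBasis {ι κ : Type*} (f : ι → κ) (hf : Function.Injective f) (i : ι) :
    pushIsometry f hf (stdBasis ι i) = stdBasis κ (f i) := by
  classical
  have h : stdBasis ι i = lp.single 2 i (1 : ℂ) := by
    rw [← (stdBasis ι).repr_self i]; rfl
  rw [h, pushIsometry, OrthogonalFamily.linearIsometry_apply_single]
  simp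

/-- The entries of the matrix `k` are bounded by `B`, and every row and every column of `k` has
at most `n` nonzero entries. -/
structure IsBandMatrix {ι : Type*} (k : ι → ι → ℂ) (n : ℕ) (B : ℝ) : Prop where
  nonneg : 0 ≤ B
  bound : ∀ i j, ‖k i j‖ ≤ B
  row : ∀ i, {j | k i j ≠ 0}.encard ≤ n
  col : ∀ j, {i | k i j ≠ 0}.encard ≤ n

theorem IsBandMatrix.row_finite {ι : Type*} {k : ι → ι → ℂ} {n : ℕ} {B : ℝ}
    (hk : IsBandMatrix k n B) (i : ι) : {j | k i j ≠ 0}.Finite :=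
  Set.finite_of_encard_le_coe (hk.row i)

theorem IsBandMatrix.tsum_eq {ι : Type*} {k : ι → ι → ℂ} {n : ℕ} {B : ℝ}
    (hk : IsBandMatrix k n B) (ξ : ι → ℂ) (i : ι) :
    ∑' j, k i j * ξ j = ∑ j ∈ (hk.row_finite i).toFinset, k i j * ξ j := by
  refine tsum_eq_sum fun j hj => ?_
  have : k i j = 0 := by simpa using hj
  simp [this]

theorem IsBandMatrix.sum_le {ι : Type*} {k : ι → ι → ℂ} {n : ℕ} {B : ℝ}
    (hk : IsBandMatrix k n B) (ξ : Ell2 ι) (s : Finset ι) :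
    ∑ i ∈ s, ‖∑' j, k i j * ξ j‖ ^ 2 ≤ (n * B * ‖ξ‖) ^ 2 := by
  classical
  set R : ι → Finset ι := fun i => (hk.row_finite i).toFinset with hR
  have hmem : ∀ i j, j ∈ R i ↔ k i j ≠ 0 := fun i j => by simp [hR]
  have hcard : ∀ i, ((R i).card : ℝ) ≤ n := fun i => by
    have h := hk.row i
    rw [(hk.row_finite i).encard_eq_coe_toFinset_card] at h
    exact_mod_cast h
  have hcol : ∀ j, ((s.filter fun i => j ∈ R i).card : ℝ) ≤ n := fun j => by
    have h : ((s.filter fun i => j ∈ R i : Finset ι) : Set ι).encard ≤ n := by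
      refine (Set.encard_le_encard fun i hi => ?_).trans (hk.col j)
      have := (Finset.mem_filter.1 (Finset.mem_coe.1 hi)).2
      exact (hmem i j).1 this
    rw [Set.encard_coe_eq_coe_finsetCard] at h
    exact_mod_cast h
  have step : ∀ i, ‖∑' j, k i j * ξ j‖ ^ 2 ≤ n * B ^ 2 * ∑ j ∈ R i, ‖ξ j‖ ^ 2 := fun i => by
    rw [hk.tsum_eq]
    have h1 : ‖∑ j ∈ R i, k i j * ξ j‖ ≤ ∑ j ∈ R i, B * ‖ξ j‖ := by
      refine (norm_sum_le _ _).trans (Finset.sum_le_sum fun j _ => ?_)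
      rw [norm_mul]
      exact mul_le_mul_of_nonneg_right (hk.bound i j) (norm_nonneg _)
    have h2 := sq_sum_le_card_mul_sum_sq (s := R i) (f := fun j => B * ‖ξ j‖)
    calc ‖∑ j ∈ R i, k i j * ξ j‖ ^ 2 ≤ (∑ j ∈ R i, B * ‖ξ j‖) ^ 2 :=
          pow_le_pow_left₀ (norm_nonneg _) h1 2
      _ ≤ (R i).card * ∑ j ∈ R i, (B * ‖ξ j‖) ^ 2 := h2
      _ ≤ n * ∑ j ∈ R i, (B * ‖ξ j‖) ^ 2 :=
          mul_le_mul_of_nonneg_right (hcard i) (Finset.sum_nonneg fun _ _ => sq_nonneg _)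
      _ = n * B ^ 2 * ∑ j ∈ R i, ‖ξ j‖ ^ 2 := by
          simp_rw [mul_pow]; rw [← Finset.mul_sum, mul_assoc]
  have hB : 0 ≤ (n : ℝ) * B ^ 2 := by positivity
  have swap : ∑ i ∈ s, ∑ j ∈ R i, ‖ξ j‖ ^ 2 ≤ n * ∑ j ∈ s.biUnion R, ‖ξ j‖ ^ 2 := by
    have : ∑ i ∈ s, ∑ j ∈ R i, ‖ξ j‖ ^ 2
        = ∑ j ∈ s.biUnion R, ∑ i ∈ s.filter (fun i => j ∈ R i), ‖ξ j‖ ^ 2 := by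
      refine Finset.sum_comm' fun i j => ?_
      simp only [Finset.mem_filter, Finset.mem_biUnion]
      exact ⟨fun h => ⟨h, i, h⟩, fun h => h.1⟩
    rw [this, Finset.mul_sum]
    refine Finset.sum_le_sum fun j _ => ?_
    rw [Finset.sum_const, nsmul_eq_mul]
    exact mul_le_mul_of_nonneg_right (hcol j) (sq_nonneg _)
  have hξ : ∑ j ∈ s.biUnion R, ‖ξ j‖ ^ 2 ≤ ‖ξ‖ ^ 2 := by
    have := lp.sum_rpow_le_norm_rpow (p := 2) (by simp) ξ (s.biUnion R)
    simpa using this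
  calc ∑ i ∈ s, ‖∑' j, k i j * ξ j‖ ^ 2
      ≤ ∑ i ∈ s, n * B ^ 2 * ∑ j ∈ R i, ‖ξ j‖ ^ 2 := Finset.sum_le_sum fun i _ => step i
    _ = n * B ^ 2 * ∑ i ∈ s, ∑ j ∈ R i, ‖ξ j‖ ^ 2 := by rw [Finset.mul_sum]
    _ ≤ n * B ^ 2 * (n * ‖ξ‖ ^ 2) := by gcongr; exact swap.trans (by gcongr)
    _ = (n * B * ‖ξ‖) ^ 2 := by ring

theorem IsBandMatrix.memlp {ι : Type*} {k : ι → ι → ℂ} {n : ℕ} {B : ℝ}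
    (hk : IsBandMatrix k n B) (ξ : Ell2 ι) : Memℓp (fun i => ∑' j, k i j * ξ j) 2 :=
  memℓp_gen' (C := (n * B * ‖ξ‖) ^ 2) fun s => by simpa using hk.sum_le ξ s

/-- The bounded operator `T` on `ℓ²(ι)` with matrix `k`, that is `(T ξ)(i) = ∑_j k(i,j) ξ(j)`. -/
def matrixOp {ι : Type*} (k : ι → ι → ℂ) {n : ℕ} {B : ℝ} (hk : IsBandMatrix k n B) :
    Ell2 ι →L[ℂ] Ell2 ι :=
  LinearMap.mkContinuous
    { toFun := fun ξ => ⟨fun i => ∑' j, k i j * ξ j, hk.memlp ξ⟩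
      map_add' := fun ξ η => by
        ext i
        change ∑' j, k i j * (ξ + η : Ell2 ι) j = (∑' j, k i j * ξ j) + ∑' j, k i j * η j
        rw [hk.tsum_eq, hk.tsum_eq, hk.tsum_eq, ← Finset.sum_add_distrib]
        exact Finset.sum_congr rfl fun j _ => mul_add _ _ _
      map_smul' := fun c ξ => by
        ext i
        change ∑' j, k i j * (c • ξ : Ell2 ι) j = c * ∑' j, k i j * ξ j
        rw [hk.tsum_eq, hk.tsum_eq, Finset.mul_sum]
        exact Finset.sum_congr rfl fun j _ => mul_left_comm _ _ _ }
    (n * B)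
    fun ξ => lp.norm_le_of_forall_sum_le (p := 2) (by simp)
      (mul_nonneg (mul_nonneg n.cast_nonneg hk.nonneg) (norm_nonneg _))
      fun s => by simpa using hk.sum_le ξ s

theorem matrixOp_apply {ι : Type*} (k : ι → ι → ℂ) {n : ℕ} {B : ℝ} (hk : IsBandMatrix k n B)
    (ξ : Ell2 ι) (i : ι) : matrixOp k hk ξ i = ∑' j, k i j * ξ j := rfl

theorem norm_matrixOp_le {ι : Type*} (k : ι → ι → ℂ) {n : ℕ} {B : ℝ}
    (hk : IsBandMatrix k n B) : ‖matrixOp k hk‖ ≤ n * B :=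
  LinearMap.mkContinuous_norm_le _ (mul_nonneg n.cast_nonneg hk.nonneg) _

/-! ### The reduced C*-algebra of a groupoid -/

section Groupoid

universe v u

variable (X : Type u) [Groupoid.{v} X]

/-- The arrows of a groupoid with unit space `X`. An arrow `γ : x ⟶ y` has range `r(γ) = x` and
source `s(γ) = y`, and the product `γ₁γ₂`, defined when `s(γ₁) = r(γ₂)`, is `γ₁ ≫ γ₂`. -/
abbrev Arr : Type (max u v) := Σ x y : X, (x ⟶ y)

variable {X}

/-- The range fibre `𝒢^{(x)} = {γ : r(γ) = x}`. -/
abbrev RangeFiber (x : X) : Type (max u v) := Σ y : X, (x ⟶ y)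

/-- The arrow `α⁻¹γ`, for `α` and `γ` with the same range. -/
def invMul {x : X} (α γ : RangeFiber x) : Arr X := ⟨α.1, γ.1, Groupoid.inv α.2 ≫ γ.2⟩

variable (X) in
/-- The range and source maps of the groupoid are locally injective for the given topology on the
arrows. This is the consequence of being `r`-discrete (étale) that makes the
operators of the regular representations bounded. -/
class LocallyInjective [TopologicalSpace (Arr X)] : Prop where
  range_injOn : ∀ γ : Arr X, ∃ U ∈ nhds γ, Set.InjOn (fun δ : Arr X => δ.1) U
  source_injOn : ∀ γ : Arr X, ∃ U ∈ nhds γ, Set.InjOn (fun δ : Arr X => δ.2.1) U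

theorem exists_encard_le_of_locally_injOn {A Y : Type*} [TopologicalSpace A] {K : Set A}
    (hK : IsCompact K) (p : A → Y) (hp : ∀ a, ∃ U ∈ nhds a, Set.InjOn p U) :
    ∃ n : ℕ, ∀ y, {a ∈ K | p a = y}.encard ≤ n := by
  classical
  choose U hU hinj using hp
  obtain ⟨t, -, ht⟩ := hK.elim_nhds_subcover U fun a _ => hU a
  refine ⟨t.card, fun y => ?_⟩
  have hex : ∀ a, ∃ i, a ∈ K → i ∈ t ∧ a ∈ U i := fun a => by
    by_cases ha : a ∈ K
    · obtain ⟨i, hi, hai⟩ := Set.mem_iUnion₂.1 (ht ha)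
      exact ⟨i, fun _ => ⟨hi, hai⟩⟩
    · exact ⟨a, fun h => absurd h ha⟩
  choose g hg using hex
  rw [← Set.encard_coe_eq_coe_finsetCard]
  refine Set.encard_le_encard_of_injOn (f := g) (fun a ha => (hg a ha.1).1) ?_
  intro a ha b hb hab
  refine hinj (g a) (hg a ha.1).2 ?_ (ha.2.trans hb.2.symm)
  rw [hab]
  exact (hg b hb.1).2

theorem exists_isBandMatrix [TopologicalSpace (Arr X)] [LocallyInjective X]
    (f : CompactlySupportedContinuousMap (Arr X) ℂ) :
    ∃ nB : ℕ × ℝ, ∀ x : X,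
      IsBandMatrix (fun α γ : RangeFiber x => f (invMul α γ)) nB.1 nB.2 := by
  obtain ⟨n, hn⟩ := exists_encard_le_of_locally_injOn f.hasCompactSupport.isCompact
    (fun δ : Arr X => δ.1) LocallyInjective.range_injOn
  obtain ⟨m, hm⟩ := exists_encard_le_of_locally_injOn f.hasCompactSupport.isCompact
    (fun δ : Arr X => δ.2.1) LocallyInjective.source_injOn
  obtain ⟨B, hB⟩ := f.hasCompactSupport.exists_bound_of_continuous f.continuous
  refine ⟨(max n m, max B 0), fun x => ⟨le_max_right _ _, fun α γ => (hB _).trans (le_max_left _ _),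
    fun α => ?_, fun γ => ?_⟩⟩
  · refine le_trans ?_ ((hn α.1).trans (by exact_mod_cast le_max_left n m))
    refine Set.encard_le_encard_of_injOn (f := fun γ => invMul α γ)
      (fun γ hγ => ⟨subset_tsupport _ hγ, rfl⟩) ?_
    rintro ⟨y, γ⟩ - ⟨z, δ⟩ - h
    simp only [invMul, Sigma.mk.injEq, true_and, heq_eq_eq] at h
    obtain ⟨rfl, h⟩ := h
    simpa using h
  · refine le_trans ?_ ((hm γ.1).trans (by exact_mod_cast le_max_right n m))
    refine Set.encard_le_encard_of_injOn (f := fun α => invMul α γ)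
      (fun α hα => ⟨subset_tsupport _ hα, rfl⟩) ?_
    rintro ⟨y, δ⟩ - ⟨z, ε⟩ - h
    simp only [invMul, Sigma.mk.injEq] at h
    obtain ⟨rfl, h⟩ := h
    have h1 : Groupoid.inv δ ≫ γ.2 = Groupoid.inv ε ≫ γ.2 := by simpa using h
    have h2 : Groupoid.inv δ = Groupoid.inv ε := by
      have := congrArg (· ≫ Groupoid.inv γ.2) h1
      simpa only [Category.assoc, Groupoid.comp_inv, Category.comp_id] using this
    have h3 : δ = ε := by simpa [Groupoid.inv_eq_inv] using congrArg Groupoid.inv h2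
    rw [h3]

/-- The regular representation `π_x` of `C_c(𝒢)` on `ℓ²(𝒢^{(x)})`:
`(π_x(f) ξ)(α) = ∑_γ f(α⁻¹γ) ξ(γ)`, that is `π_x(f) δ_γ = ∑_α f(α⁻¹γ) δ_α`. -/
def regRep [TopologicalSpace (Arr X)] [LocallyInjective X] (x : X)
    (f : CompactlySupportedContinuousMap (Arr X) ℂ) :
    Ell2 (RangeFiber x) →L[ℂ] Ell2 (RangeFiber x) :=
  matrixOp (fun α γ : RangeFiber x => f (invMul α γ)) ((exists_isBandMatrix f).choose_spec x)

theorem regRep_apply [TopologicalSpace (Arr X)] [LocallyInjective X] (x : X)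
    (f : CompactlySupportedContinuousMap (Arr X) ℂ) (ξ : Ell2 (RangeFiber x)) (α : RangeFiber x) :
    regRep x f ξ α = ∑' γ, f (invMul α γ) * ξ γ := rfl

variable (X) in
/-- The C*-algebra of bounded families `(T_x)_x` of bounded operators on the spaces
`ℓ²(𝒢^{(x)})`, with the norm `sup_x ‖T_x‖` and pointwise operations. -/
def RegularProduct : Type _ :=
  lp (fun x : X => Ell2 (RangeFiber x) →L[ℂ] Ell2 (RangeFiber x)) ⊤

instance : NonUnitalCStarAlgebra (RegularProduct X) :=
  inferInstanceAs (NonUnitalCStarAlgebra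
    (lp (fun x : X => Ell2 (RangeFiber x) →L[ℂ] Ell2 (RangeFiber x)) ⊤))

/-- The family `(π_x(f))_x`; its norm is the reduced norm `‖f‖_red = sup_x ‖π_x(f)‖`. -/
def totalRegRep [TopologicalSpace (Arr X)] [LocallyInjective X]
    (f : CompactlySupportedContinuousMap (Arr X) ℂ) : RegularProduct X :=
  ⟨fun x => regRep x f, memℓp_infty
    ⟨_, by rintro _ ⟨x, rfl⟩; exact norm_matrixOp_le _ ((exists_isBandMatrix f).choose_spec x)⟩⟩

variable (X) in
/-- The reduced C*-algebra `C*_red(𝒢)`, the completion of `C_c(𝒢)` in the reduced norm, realised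
as the C*-algebra generated by the image of the isometric map `f ↦ (π_x(f))_x`. For an étale
groupoid this image is the image of a *-homomorphism of the convolution algebra `C_c(𝒢)`, hence
already a *-algebra, and only its closure has to be taken. -/
def ReducedCStar [TopologicalSpace (Arr X)] [LocallyInjective X] :
    NonUnitalStarSubalgebra ℂ (RegularProduct X) :=
  (NonUnitalStarAlgebra.adjoin ℂ (Set.range (totalRegRep (X := X)))).topologicalClosure

end Groupoid

/-! ### The pair `(N ⋊ H, M)` -/

section Pair

variable {N H : Type*} [Group N] [Group H] (φ : H →* MulAut N) (M : Subgroup N)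

/-- The subgroup `aMa⁻¹` of `N`, for `a ∈ H`; in `N ⋊ H` one has `ana⁻¹ = φ a n`. -/
def conjSub (a : H) : Subgroup N := M.map (φ a).toMonoidHom

theorem mem_conjSub {a : H} {n : N} : n ∈ conjSub φ M a ↔ ∃ m ∈ M, φ a m = n := Iff.rfl

/-- The semigroup `P = {a ∈ H : aMa⁻¹ ⊆ M}`. -/
def P : Submonoid H where
  carrier := {a | conjSub φ M a ≤ M}
  one_mem' := by rintro _ ⟨m, hm, rfl⟩; simpa using hm
  mul_mem' := by
    rintro a b ha hb _ ⟨m, hm, rfl⟩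
    have h := ha (Subgroup.mem_map_of_mem _ (hb (Subgroup.mem_map_of_mem _ hm)))
    rw [map_mul]
    exact h

/-! #### The C*-algebra of the regular representation -/

variable {φ M} in
theorem conj_mem {a : H} (ha : a ∈ P φ M) {m : N} (hm : m ∈ M) : φ a m ∈ M := ha ⟨m, hm, rfl⟩

theorem conj_injective (a : P φ M) : Function.Injective (fun p : M × H =>
    ((⟨φ a p.1, conj_mem a.2 p.1.2⟩ : M), (a : H) * p.2)) := by
  rintro ⟨m, b⟩ ⟨m', b'⟩ h
  have h1 : φ (a : H) (m : N) = φ (a : H) (m' : N) := congrArg (fun p => ((p.1 : M) : N)) h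
  have h2 : (a : H) * b = (a : H) * b' := congrArg Prod.snd h
  exact Prod.ext (Subtype.ext ((φ (a : H)).injective h1)) (mul_left_cancel h2)

theorem translate_injective {N H : Type*} [Group N] (M : Subgroup N) (m : M) :
    Function.Injective (fun p : M × H => (m * p.1, p.2)) := by
  rintro ⟨n, b⟩ ⟨n', b'⟩ h
  have h1 : m * n = m * n' := congrArg Prod.fst h
  have h2 : b = b' := congrArg Prod.snd h
  exact Prod.ext (mul_left_cancel h1) h2

/-- The isometry `S_a (δ_n ⊗ δ_b) = δ_{ana⁻¹} ⊗ δ_{ab}` on `ℓ²(M) ⊗ ℓ²(H) = ℓ²(M × H)`. -/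
def S (a : P φ M) : Ell2 (M × H) →L[ℂ] Ell2 (M × H) :=
  (pushIsometry _ (conj_injective φ M a)).toContinuousLinearMap

/-- The unitary `U(m) (δ_n ⊗ δ_b) = δ_{mn} ⊗ δ_b` on `ℓ²(M) ⊗ ℓ²(H) = ℓ²(M × H)`. -/
def U (m : M) : Ell2 (M × H) →L[ℂ] Ell2 (M × H) :=
  (pushIsometry _ (translate_injective (H := H) M m)).toContinuousLinearMap

theorem S_stdBasis (a : P φ M) (n : M) (b : H) :
    S φ M a (stdBasis (M × H) (n, b))
      = stdBasis (M × H) (⟨φ a n, conj_mem a.2 n.2⟩, (a : H) * b) :=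
  pushIsometry_stdBasis _ (conj_injective φ M a) _

theorem U_stdBasis {N H : Type*} [Group N] (M : Subgroup N) (m n : M) (b : H) :
    U M m (stdBasis (M × H) (n, b)) = stdBasis (M × H) (m * n, b) :=
  pushIsometry_stdBasis _ (translate_injective M m) _

/-- `𝔄_r[N ⋊ H, M]`: the C*-algebra of operators on `ℓ²(M) ⊗ ℓ²(H)` generated by the isometries
`S_a`, `a ∈ P`, and the unitaries `U(m)`, `m ∈ M`, that is, the image of the regular
representation `s_a ↦ S_a`, `u(m) ↦ U(m)`. -/
def RegularAlgebra : StarSubalgebra ℂ (Ell2 (M × H) →L[ℂ] Ell2 (M × H)) :=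
  (StarAlgebra.adjoin ℂ (Set.range (S φ M) ∪ Set.range (U (H := H) M))).topologicalClosure

/-! #### The completion `N̄` and the groupoid `N̄ ⋊ G|_{M̄}` -/

/-- The (profinite) completion `N̄` of `N` with respect to the group topology with neighbourhood
base `{aMa⁻¹ : a ∈ H}` at the identity: the inverse limit of the discrete quotients `N / aMa⁻¹`,
`a ∈ H`, along the quotient maps `N / aMa⁻¹ → N / bMb⁻¹` for `aMa⁻¹ ⊆ bMb⁻¹`. -/
@[ext]
structure Nbar where
  /-- The coordinate in `N / aMa⁻¹`. -/
  coord : ∀ a : H, N ⧸ conjSub φ M a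
  compat : ∀ (a b : H) (h : conjSub φ M a ≤ conjSub φ M b),
    Subgroup.quotientMapOfLE h (coord a) = coord b

/-- The subspace topology of the product of the discrete spaces `N / aMa⁻¹`. -/
instance : TopologicalSpace (Nbar φ M) :=
  TopologicalSpace.induced Nbar.coord (@Pi.topologicalSpace H _ fun _ => ⊥)

/-- The canonical map `N → N̄`. -/
def ofN (n : N) : Nbar φ M := ⟨fun _ => (n : N ⧸ _), fun _ _ _ => rfl⟩

variable {φ M}

/-- For `g = nh ∈ N ⋊ H`, the map `N / h⁻¹aM(h⁻¹a)⁻¹ → N / aMa⁻¹` sending the class of `k` to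
the class of `n(hkh⁻¹)`. -/
def smulQuot (g : N ⋊[φ] H) (a : H) : N ⧸ conjSub φ M (g.right⁻¹ * a) → N ⧸ conjSub φ M a :=
  Quotient.map' (fun k => g.left * φ g.right k) (by
    intro k k' h
    rw [QuotientGroup.leftRel_apply] at h ⊢
    obtain ⟨m, hm, hmk⟩ := (mem_conjSub φ M).1 h
    refine (mem_conjSub φ M).2 ⟨m, hm, ?_⟩
    have := congrArg (φ g.right) hmk
    rw [← MulAut.mul_apply, ← map_mul, mul_inv_cancel_left] at this
    rw [this]
    simp [mul_assoc])

theorem smulQuot_mk (g : N ⋊[φ] H) (a : H) (k : N) :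
    smulQuot g a (k : N ⧸ conjSub φ M (g.right⁻¹ * a))
      = ((g.left * φ g.right k : N) : N ⧸ conjSub φ M a) := rfl

theorem Nbar.coord_congr (x : Nbar φ M) {a b : H} (h : a = b) {n : N}
    (hn : x.coord a = (n : N ⧸ conjSub φ M a)) : x.coord b = (n : N ⧸ conjSub φ M b) := by
  subst h; exact hn

theorem conjSub_mul_le (h : H) {a b : H} (hab : conjSub φ M a ≤ conjSub φ M b) :
    conjSub φ M (h * a) ≤ conjSub φ M (h * b) := by
  rintro _ ⟨m, hm, rfl⟩
  obtain ⟨m', hm', he⟩ := hab ⟨m, hm, rfl⟩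
  refine ⟨m', hm', ?_⟩
  have := congrArg (φ h) he
  simpa using this

/-- The left action of `G = N ⋊ H` on `N̄`: the element `nh` acts by `x ↦ n(hxh⁻¹)`, where `N` acts
by left translation and `h x h⁻¹` is the continuous extension of the conjugation by `h` on `N`. -/
instance : MulAction (N ⋊[φ] H) (Nbar φ M) where
  smul g x := ⟨fun a => smulQuot g a (x.coord (g.right⁻¹ * a)), by
    intro a b hab
    have h' := conjSub_mul_le (φ := φ) (M := M) g.right⁻¹ hab
    change Subgroup.quotientMapOfLE hab (smulQuot g a (x.coord (g.right⁻¹ * a)))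
      = smulQuot g b (x.coord (g.right⁻¹ * b))
    rw [← x.compat _ _ h']
    obtain ⟨k, hk⟩ := QuotientGroup.mk_surjective (x.coord (g.right⁻¹ * a))
    rw [← hk]
    rfl⟩
  one_smul x := by
    refine Nbar.ext (funext fun a => ?_)
    obtain ⟨k, hk⟩ := QuotientGroup.mk_surjective (x.coord a)
    have h1 : x.coord ((1 : N ⋊[φ] H).right⁻¹ * a) = (k : N ⧸ _) :=
      x.coord_congr (by simp) hk.symm
    change smulQuot 1 a (x.coord _) = x.coord a
    rw [h1, smulQuot_mk, ← hk]
    simp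
  mul_smul g g' x := by
    refine Nbar.ext (funext fun a => ?_)
    obtain ⟨k, hk⟩ := QuotientGroup.mk_surjective (x.coord (g'.right⁻¹ * (g.right⁻¹ * a)))
    have h1 : x.coord ((g * g').right⁻¹ * a) = (k : N ⧸ _) :=
      x.coord_congr (by simp [mul_assoc]) hk.symm
    change smulQuot (g * g') a (x.coord _) = smulQuot g a (smulQuot g' _ (x.coord _))
    rw [h1, ← hk, smulQuot_mk, smulQuot_mk, smulQuot_mk]
    simp [mul_assoc]

theorem smul_ofN (g : N ⋊[φ] H) (n : N) :
    g • ofN φ M n = ofN φ M (g.left * φ g.right n) := rfl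

variable (φ M)

/-- The closure `M̄` of `M` in `N̄`. -/
@[ext]
structure Mbar where
  /-- The underlying point of `N̄`. -/
  val : Nbar φ M
  mem : val ∈ closure (ofN φ M '' (M : Set N))

/-- The groupoid `𝒢 = N̄ ⋊ G|_{M̄}`: the transformation groupoid of the right action
`x.g = g⁻¹x` of `G = N ⋊ H` on `N̄`, restricted to `M̄`. Its arrows are the pairs `(x, g)` with
`x ∈ M̄` and `x.g ∈ M̄`; the range of `(x, g)` is `x`, its source is `x.g`, the product is
`(x, g)(x.g, g') = (x, gg')`, and `(x, g)⁻¹ = (x.g, g⁻¹)`. -/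
instance : Groupoid (Mbar φ M) where
  Hom x y := {g : N ⋊[φ] H // g⁻¹ • x.val = y.val}
  id x := ⟨1, by simp⟩
  comp α β := ⟨α.1 * β.1, by rw [mul_inv_rev, mul_smul, α.2, β.2]⟩
  inv α := ⟨α.1⁻¹, by rw [inv_inv, smul_eq_iff_eq_inv_smul]; exact α.2.symm⟩
  id_comp α := Subtype.ext (one_mul _)
  comp_id α := Subtype.ext (mul_one _)
  assoc α β γ := Subtype.ext (mul_assoc _ _ _)
  inv_comp α := Subtype.ext (inv_mul_cancel _)
  comp_inv α := Subtype.ext (mul_inv_cancel _)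

/-- The subspace topology of `N̄ × G`, where `G` is discrete. -/
instance : TopologicalSpace (Arr (Mbar φ M)) :=
  TopologicalSpace.induced (fun γ => ((γ.1.val, γ.2.2.1) : Nbar φ M × (N ⋊[φ] H)))
    (@instTopologicalSpaceProd _ _ _ ⊥)

instance : LocallyInjective (Mbar φ M) := by
  have key : ∀ γ : Arr (Mbar φ M), {δ : Arr (Mbar φ M) | δ.2.2.1 = γ.2.2.1} ∈ nhds γ := by
    intro γ
    let _ : TopologicalSpace (N ⋊[φ] H) := ⊥
    have : DiscreteTopology (N ⋊[φ] H) := ⟨rfl⟩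
    have hc : Continuous fun δ : Arr (Mbar φ M) =>
        ((δ.1.val, δ.2.2.1) : Nbar φ M × (N ⋊[φ] H)) := continuous_induced_dom
    exact ((isOpen_discrete {γ.2.2.1}).preimage (continuous_snd.comp hc)).mem_nhds rfl
  have ext : ∀ δ ε : Arr (Mbar φ M), δ.1 = ε.1 → δ.2.2.1 = ε.2.2.1 → δ = ε := by
    rintro ⟨x, y, g, hg⟩ ⟨x', y', g', hg'⟩ h1 h2
    dsimp only at h1 h2
    subst h1 h2
    obtain rfl : y = y' := Mbar.ext (hg.symm.trans hg')
    rfl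
  refine ⟨fun γ => ⟨_, key γ, fun δ hδ ε hε h => ext δ ε h (hδ.trans hε.symm)⟩,
    fun γ => ⟨_, key γ, fun δ hδ ε hε h => ext δ ε ?_ (hδ.trans hε.symm)⟩⟩
  have h' : δ.2.1 = ε.2.1 := h
  have hg : δ.2.2.1 = ε.2.2.1 := hδ.trans hε.symm
  refine Mbar.ext (MulAction.injective (δ.2.2.1)⁻¹ ?_)
  change (δ.2.2.1)⁻¹ • δ.1.val = (δ.2.2.1)⁻¹ • ε.1.val
  rw [δ.2.2.2, hg, ε.2.2.2, h']

end Pair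

end CuntzLi

end

noncomputable section

namespace CuntzLi

open ContinuousLinearMap

/-! ### Matrix coefficients and isometries permuting basis vectors -/

section Hilbert

variable {ι κ : Type*}

/-! The isomorphism is the regular representation at the single unit e of the closure of M. An arrow
(e, g) lies in the groupoid exactly when g⁻¹ = mb with m in M and b in H, because the closure of M
meets N only in M. So the range fibre at e is indexed by M × H (`pairArrow_bijective`), and π_e
becomes a representation `cornerRep` on ℓ²(M × H).

This one representation already computes the reduced norm. Transported to ℓ²(G), the operators
π_x(f) form a field in x that is strongly continuous and equivariant under arrows. The norm is
therefore constant on orbits, and a bound at e passes to limits of its orbit. That orbit contains M,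
which is dense, so the supremum over x is attained at e (`IsContinuousField.norm_le`,
`norm_le_of_mem_reducedCStar`).

It remains to identify the image. Let `compress M k` be the compression to ℓ²(M × H) of left
translation by k in G. Then π_e(f) is a finite sum of products (multiplication by f(·, k)) ·
`compress M k` (`cornerRep_totalRegRep_eq_sum`). The compressions lie in the target algebra since H
= P⁻¹P (`compress_mem`). The multiplication operators lie there by Stone–Weierstrass on the compact
closure of M, since U(m)S_cS_c*U(m)* is the indicator of a coset of cMc⁻¹ (`diagonalOp_mem`).
Conversely, U(m) and S_a are themselves compressions, and `compress M k` is the image of the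
indicator of the compact open set of arrows with group element k (`exists_cornerRep_eq`). An
isometric image is closed, so all of the target is reached. -/

theorem inner_stdBasis (i : ι) (ξ : Ell2 ι) : inner ℂ (stdBasis ι i) ξ = ξ i :=
  ((stdBasis ι).repr_apply_apply ξ i).symm

theorem stdBasis_apply (i j : ι) [Decidable (i = j)] :
    (stdBasis ι i) j = if i = j then 1 else 0 := by
  classical
  rw [← inner_stdBasis, orthonormal_iff_ite.1 (stdBasis ι).orthonormal]
  exact if_congr eq_comm rfl rfl

theorem stdBasis_apply_self (i : ι) : (stdBasis ι i) i = 1 := by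
  classical exact (stdBasis_apply i i).trans (if_pos rfl)

theorem stdBasis_apply_ne {i j : ι} (h : i ≠ j) : (stdBasis ι i) j = 0 := by
  classical exact (stdBasis_apply i j).trans (if_neg h)

theorem op_ext {A B : Ell2 ι →L[ℂ] Ell2 κ}
    (h : ∀ i, A (stdBasis ι i) = B (stdBasis ι i)) : A = B := by
  refine ContinuousLinearMap.ext_on (s := Set.range (stdBasis ι)) ?_ ?_
  · have := (stdBasis ι).dense_span
    exact Submodule.dense_iff_topologicalClosure_eq_top.2 this
  · rintro _ ⟨i, rfl⟩
    exact h i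

theorem adjoint_apply_stdBasis (A : Ell2 ι →L[ℂ] Ell2 κ) (i : ι) (j : κ) :
    (adjoint A (stdBasis κ j)) i = star ((A (stdBasis ι i)) j) := by
  rw [← inner_stdBasis, adjoint_inner_right, ← inner_stdBasis, ← inner_conj_symm]
  rfl

/-- The isometry `δ_i ↦ δ_{f i}` as a bounded operator. -/
abbrev push (f : ι → κ) (hf : Function.Injective f) : Ell2 ι →L[ℂ] Ell2 κ :=
  (pushIsometry f hf).toContinuousLinearMap

theorem push_stdBasis (f : ι → κ) (hf : Function.Injective f) (i : ι) :
    push f hf (stdBasis ι i) = stdBasis κ (f i) := pushIsometry_stdBasis f hf i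

theorem adjoint_push_apply (f : ι → κ) (hf : Function.Injective f) (η : Ell2 κ) (i : ι) :
    (adjoint (push f hf) η) i = η (f i) := by
  rw [← inner_stdBasis, adjoint_inner_right, push_stdBasis, inner_stdBasis]

theorem adjoint_push_stdBasis (f : ι → κ) (hf : Function.Injective f) (i : ι) :
    adjoint (push f hf) (stdBasis κ (f i)) = stdBasis ι i := by
  classical
  ext j
  rw [adjoint_push_apply]
  by_cases h : i = j
  · rw [h, stdBasis_apply_self, stdBasis_apply_self]
  · rw [stdBasis_apply_ne h, stdBasis_apply_ne (hf.ne h)]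

theorem adjoint_push_stdBasis_of_notMem (f : ι → κ) (hf : Function.Injective f) {k : κ}
    (hk : k ∉ Set.range f) : adjoint (push f hf) (stdBasis κ k) = 0 := by
  ext j
  rw [adjoint_push_apply, stdBasis_apply_ne fun h => hk ⟨j, h.symm⟩]
  rfl

theorem adjoint_push_comp_push (f : ι → κ) (hf : Function.Injective f) :
    adjoint (push f hf) ∘L push f hf = 1 :=
  op_ext fun i => by
    rw [comp_apply, push_stdBasis, adjoint_push_stdBasis]
    rfl

theorem push_comp_adjoint_push (f : ι → κ) (hf : Function.Bijective f) :
    push f hf.1 ∘L adjoint (push f hf.1) = 1 :=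
  op_ext fun k => by
    obtain ⟨i, rfl⟩ := hf.2 k
    rw [comp_apply, adjoint_push_stdBasis, push_stdBasis]
    rfl

theorem push_apply (f : ι → κ) (hf : Function.Injective f) (ξ : Ell2 ι) (i : ι) :
    (push f hf ξ) (f i) = ξ i := by
  rw [← adjoint_push_apply f hf]
  exact congrArg (fun η : Ell2 ι => η i) (DFunLike.congr_fun (adjoint_push_comp_push f hf) ξ)

theorem push_apply_of_notMem (f : ι → κ) (hf : Function.Injective f) (ξ : Ell2 ι) {k : κ}
    (hk : k ∉ Set.range f) : (push f hf ξ) k = 0 := by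
  rw [← inner_stdBasis, ← adjoint_inner_left, adjoint_push_stdBasis_of_notMem f hf hk,
    inner_zero_left]

theorem matrixOp_stdBasis (k : ι → ι → ℂ) {n : ℕ} {B : ℝ} (hk : IsBandMatrix k n B) (i j : ι) :
    (matrixOp k hk (stdBasis ι j)) i = k i j := by
  rw [matrixOp_apply, tsum_eq_single j]
  · rw [stdBasis_apply_self, mul_one]
  · intro l hl
    rw [stdBasis_apply_ne hl.symm, mul_zero]

end Hilbert

/-! ### Conjugation by an isometry -/

section Conj

variable {E F : Type*} [NormedAddCommGroup E] [InnerProductSpace ℂ E] [CompleteSpace E]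
  [NormedAddCommGroup F] [InnerProductSpace ℂ F] [CompleteSpace F]

/-- The *-homomorphism `A ↦ W A W*` attached to an isometry `W`. -/
def conjHom (W : E →L[ℂ] F) (hW : adjoint W ∘L W = 1) : (E →L[ℂ] E) →⋆ₙₐ[ℂ] (F →L[ℂ] F) where
  toFun A := W ∘L A ∘L adjoint W
  map_smul' c A := by ext; simp
  map_zero' := by ext; simp
  map_add' A B := by ext; simp
  map_mul' A B := by
    have h : ∀ v, adjoint W (W v) = v := fun v => DFunLike.congr_fun hW v
    ext; simp [h]
  map_star' A := by
    simp only [star_eq_adjoint, adjoint_comp, adjoint_adjoint]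
    rfl

theorem conjHom_apply (W : E →L[ℂ] F) (hW : adjoint W ∘L W = 1) (A : E →L[ℂ] E) :
    conjHom W hW A = W ∘L A ∘L adjoint W := rfl

theorem conjHom_injective (W : E →L[ℂ] F) (hW : adjoint W ∘L W = 1) :
    Function.Injective (conjHom W hW) := by
  intro A B h
  have hv : ∀ v, adjoint W (W v) = v := fun v => DFunLike.congr_fun hW v
  ext v
  have := congrArg (adjoint W) (DFunLike.congr_fun h (W v))
  simpa [conjHom_apply, hv] using this

/-- An injective *-homomorphism between C*-algebras is automatically isometric. -/
theorem norm_conjHom (W : E →L[ℂ] F) (hW : adjoint W ∘L W = 1) (A : E →L[ℂ] E) :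
    ‖conjHom W hW A‖ = ‖A‖ :=
  NonUnitalStarAlgHom.norm_map _ (conjHom_injective W hW) A

end Conj

section Completion

variable {N H : Type*} [Group N] [Group H] {φ : H →* MulAut N} {M : Subgroup N}

/-! ### The topology of the completion -/

theorem Nbar.continuous_coord (a : H) :
    @Continuous (Nbar φ M) _ _ ⊥ fun x : Nbar φ M => x.coord a := by
  -- The discrete topology used in the definition of `Nbar` is made a local instance, so that the
  -- product-topology lemmas apply.
  let _ : ∀ a : H, TopologicalSpace (N ⧸ conjSub φ M a) := fun _ => ⊥
  exact (continuous_apply a).comp continuous_induced_dom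

theorem Nbar.isOpen_coord_mem (a : H) (s : Set (N ⧸ conjSub φ M a)) :
    IsOpen {x : Nbar φ M | x.coord a ∈ s} := by
  let _ : TopologicalSpace (N ⧸ conjSub φ M a) := ⊥
  have : DiscreteTopology (N ⧸ conjSub φ M a) := ⟨rfl⟩
  exact (isOpen_discrete s).preimage (Nbar.continuous_coord a)

theorem Nbar.isClopen_coord_mem (a : H) (s : Set (N ⧸ conjSub φ M a)) :
    IsClopen {x : Nbar φ M | x.coord a ∈ s} :=
  ⟨⟨Nbar.isOpen_coord_mem a sᶜ⟩, Nbar.isOpen_coord_mem a s⟩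

theorem Nbar.continuous_smul (g : N ⋊[φ] H) : Continuous fun x : Nbar φ M => g • x := by
  let _ : ∀ a : H, TopologicalSpace (N ⧸ conjSub φ M a) := fun _ => ⊥
  have : ∀ a : H, DiscreteTopology (N ⧸ conjSub φ M a) := fun _ => ⟨rfl⟩
  refine continuous_induced_rng.2 (continuous_pi fun a => ?_)
  exact (continuous_of_discreteTopology (f := smulQuot (M := M) g a)).comp
    (Nbar.continuous_coord (g.right⁻¹ * a))

/-! ### Directedness of the conjugates of M, and the closure of M as a clopen set -/

theorem conjSub_one : conjSub φ M 1 = M := by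
  ext n
  simp [mem_conjSub]

theorem conjSub_mul_right_le (a : H) {p : H} (hp : p ∈ P φ M) :
    conjSub φ M (a * p) ≤ conjSub φ M a := by
  have h : conjSub φ M p ≤ conjSub φ M 1 := by
    rw [conjSub_one]
    exact hp
  simpa using conjSub_mul_le (φ := φ) (M := M) a h

/-- This is the Ore condition: H = PP⁻¹ gives any two elements a common right multiple, and right
multiplication by P shrinks the conjugate. Keeping c in P places the small subgroup inside M. -/
theorem exists_conjSub_le (hP : ∀ h : H, ∃ a ∈ P φ M, ∃ b ∈ P φ M, h = a * b⁻¹) (s : Finset H) :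
    ∃ c ∈ P φ M, ∀ a ∈ s, conjSub φ M c ≤ conjSub φ M a := by
  classical
  induction s using Finset.induction_on with
  | empty => exact ⟨1, (P φ M).one_mem, by simp⟩
  | insert a s _ ih =>
    obtain ⟨c, hc, hs⟩ := ih
    obtain ⟨p, hp, q, hq, h⟩ := hP (c⁻¹ * a)
    have he : c * p = a * q := by
      rw [inv_mul_eq_iff_eq_mul] at h
      rw [h]
      group
    refine ⟨c * p, (P φ M).mul_mem hc hp, fun b hb => ?_⟩
    rcases Finset.mem_insert.1 hb with rfl | hb
    · rw [he]
      exact conjSub_mul_right_le _ hq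
    · exact (conjSub_mul_right_le _ hp).trans (hs b hb)

theorem Nbar.exists_coord_eq_subset
    (hP : ∀ h : H, ∃ a ∈ P φ M, ∃ b ∈ P φ M, h = a * b⁻¹) {x : Nbar φ M} {V : Set (Nbar φ M)}
    (hV : IsOpen V) (hx : x ∈ V) : ∃ c ∈ P φ M, ∀ y : Nbar φ M, y.coord c = x.coord c → y ∈ V := by
  let _ : ∀ a : H, TopologicalSpace (N ⧸ conjSub φ M a) := fun _ => ⊥
  obtain ⟨W, hW, rfl⟩ := isOpen_induced_iff.1 hV
  obtain ⟨s, u, hu, hs⟩ := isOpen_pi_iff.1 hW _ hx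
  obtain ⟨c, hc, hle⟩ := exists_conjSub_le hP s
  refine ⟨c, hc, fun y hy => hs fun a ha => ?_⟩
  rw [← y.compat c a (hle a ha), hy, x.compat c a (hle a ha)]
  exact (hu a ha).2

theorem Nbar.mem_closure_iff (hP : ∀ h : H, ∃ a ∈ P φ M, ∃ b ∈ P φ M, h = a * b⁻¹)
    (x : Nbar φ M) : x ∈ closure (ofN φ M '' (M : Set N)) ↔ x.coord 1 = ((1 : N) : N ⧸ _) := by
  constructor
  · intro h
    have hcl := (Nbar.isClopen_coord_mem 1 {((1 : N) : N ⧸ conjSub φ M 1)}).1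
    refine Set.mem_singleton_iff.1 (closure_minimal ?_ hcl h)
    rintro _ ⟨m, hm, rfl⟩
    refine (QuotientGroup.eq.2 ?_ : ((m : N) : N ⧸ conjSub φ M 1) = ((1 : N) : N ⧸ _))
    rw [conjSub_one]
    simpa using hm
  · intro h
    refine _root_.mem_closure_iff.2 fun V hV hx => ?_
    obtain ⟨c, hc, hcV⟩ := Nbar.exists_coord_eq_subset hP hV hx
    -- A representative at the fine level c also represents the coordinate at level 1, where the
    -- subgroup is M; since that coordinate is trivial, n lies in M.
    obtain ⟨n, hn⟩ := QuotientGroup.mk_surjective (x.coord c)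
    have hle : conjSub φ M c ≤ conjSub φ M 1 := by
      rw [conjSub_one]
      exact hc
    have h1 := x.compat c 1 hle
    rw [h, ← hn] at h1
    have h2 := QuotientGroup.eq.1 h1
    rw [conjSub_one] at h2
    exact ⟨ofN φ M n, hcV _ hn, n, by simpa using h2, rfl⟩

theorem isClopen_closure (hP : ∀ h : H, ∃ a ∈ P φ M, ∃ b ∈ P φ M, h = a * b⁻¹) :
    IsClopen (closure (ofN φ M '' (M : Set N))) := by
  have : closure (ofN φ M '' (M : Set N))
      = {x : Nbar φ M | x.coord 1 ∈ ({((1 : N) : N ⧸ conjSub φ M 1)} : Set _)} :=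
    Set.ext fun x => by rw [Nbar.mem_closure_iff hP x]; rfl
  rw [this]
  exact Nbar.isClopen_coord_mem _ _

theorem ofN_mem_closure_iff (hP : ∀ h : H, ∃ a ∈ P φ M, ∃ b ∈ P φ M, h = a * b⁻¹) (n : N) :
    ofN φ M n ∈ closure (ofN φ M '' (M : Set N)) ↔ n ∈ M := by
  refine ⟨fun h => ?_, fun h => subset_closure ⟨n, h, rfl⟩⟩
  have := QuotientGroup.eq.1 ((Nbar.mem_closure_iff hP _).1 h)
  rw [conjSub_one] at this
  simpa using this

/-- A point of the closure of `M` is represented in `N / aMa⁻¹` by an element of `M`. -/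
theorem Nbar.exists_mem_coord_eq {x : Nbar φ M} (hx : x ∈ closure (ofN φ M '' (M : Set N))) (a : H) :
    ∃ m ∈ M, x.coord a = (m : N ⧸ _) := by
  obtain ⟨_, h, m, hm, rfl⟩ := _root_.mem_closure_iff.1 hx {y | y.coord a ∈ {x.coord a}}
    (Nbar.isOpen_coord_mem a _) rfl
  exact ⟨m, hm, h.symm⟩

/-! ### Compactness of the closure of M -/

theorem finite_image_mk (hP : ∀ h : H, ∃ a ∈ P φ M, ∃ b ∈ P φ M, h = a * b⁻¹)
    (hfin : ∀ a ∈ P φ M, ((conjSub φ M a).subgroupOf M).FiniteIndex) (a : H) :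
    ((fun n : N => (n : N ⧸ conjSub φ M a)) '' (M : Set N)).Finite := by
  obtain ⟨c, hc, hle⟩ := exists_conjSub_le hP {a}
  have := hfin c hc
  have : Finite (Quotient (QuotientGroup.leftRel ((conjSub φ M c).subgroupOf M))) :=
    inferInstanceAs (Finite (M ⧸ (conjSub φ M c).subgroupOf M))
  refine (Set.finite_range (Quotient.lift (s := QuotientGroup.leftRel ((conjSub φ M c).subgroupOf M))
    (fun m : M => ((m : N) : N ⧸ conjSub φ M a)) ?_)).subset ?_
  · intro m m' h
    have h' := QuotientGroup.leftRel_apply.1 h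
    exact QuotientGroup.eq.2 (hle a (Finset.mem_singleton_self a) h')
  · rintro _ ⟨m, hm, rfl⟩
    exact ⟨Quotient.mk _ ⟨m, hm⟩, rfl⟩

/-- Tychonoff: the completion is closed in the product of the discrete quotients, and on the closure
of M each coordinate takes only finitely many values. -/
theorem isCompact_closure (hP : ∀ h : H, ∃ a ∈ P φ M, ∃ b ∈ P φ M, h = a * b⁻¹)
    (hfin : ∀ a ∈ P φ M, ((conjSub φ M a).subgroupOf M).FiniteIndex) :
    IsCompact (closure (ofN φ M '' (M : Set N))) := by
  let _ : ∀ a : H, TopologicalSpace (N ⧸ conjSub φ M a) := fun _ => ⊥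
  have : ∀ a : H, DiscreteTopology (N ⧸ conjSub φ M a) := fun _ => ⟨rfl⟩
  have hind : Topology.IsInducing (Nbar.coord : Nbar φ M → _) := ⟨rfl⟩
  have hrange : IsClosed (Set.range (Nbar.coord : Nbar φ M → _)) := by
    have : Set.range (Nbar.coord : Nbar φ M → _) = ⋂ (a : H) (b : H)
        (h : conjSub φ M a ≤ conjSub φ M b), {u | Subgroup.quotientMapOfLE h (u a) = u b} := by
      ext u
      simp only [Set.mem_iInter, Set.mem_ofPred_eq]
      exact ⟨by rintro ⟨x, rfl⟩; exact x.compat, fun h => ⟨⟨u, h⟩, rfl⟩⟩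
    rw [this]
    refine isClosed_iInter fun a => isClosed_iInter fun b => isClosed_iInter fun h => ?_
    exact isClosed_eq ((continuous_of_discreteTopology
      (f := Subgroup.quotientMapOfLE h)).comp (continuous_apply a)) (continuous_apply b)
  have hemb : Topology.IsClosedEmbedding (Nbar.coord : Nbar φ M → _) :=
    ⟨⟨hind, fun x y h => Nbar.ext h⟩, hrange⟩
  have hK := hemb.isCompact_preimage
    (isCompact_univ_pi fun a : H => (finite_image_mk hP hfin a).isCompact)
  refine hK.of_isClosed_subset isClosed_closure fun x hx a _ => ?_
  obtain ⟨m, hm, h⟩ := Nbar.exists_mem_coord_eq hx a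
  exact ⟨m, hm, h.symm⟩

/-- The subspace topology of the closure of `M`. -/
instance : TopologicalSpace (Mbar φ M) := TopologicalSpace.induced Mbar.val inferInstance

theorem Mbar.continuous_val : Continuous (Mbar.val : Mbar φ M → Nbar φ M) :=
  continuous_induced_dom

theorem Mbar.range_val :
    Set.range (Mbar.val : Mbar φ M → Nbar φ M) = closure (ofN φ M '' (M : Set N)) :=
  Set.ext fun x => ⟨by rintro ⟨y, rfl⟩; exact y.mem, fun h => ⟨⟨x, h⟩, rfl⟩⟩

theorem Mbar.compactSpace (hP : ∀ h : H, ∃ a ∈ P φ M, ∃ b ∈ P φ M, h = a * b⁻¹)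
    (hfin : ∀ a ∈ P φ M, ((conjSub φ M a).subgroupOf M).FiniteIndex) :
    CompactSpace (Mbar φ M) := by
  refine ⟨(Topology.IsInducing.isCompact_iff ⟨rfl⟩ (f := Mbar.val)).2 ?_⟩
  rw [Set.image_univ, Mbar.range_val]
  exact isCompact_closure hP hfin

variable (φ M) in
/-- The canonical map `M → M̄`. -/
def Mbar.ofM (m : M) : Mbar φ M := ⟨ofN φ M m, subset_closure ⟨m, m.2, rfl⟩⟩

theorem Mbar.denseRange_ofM : DenseRange (Mbar.ofM φ M) := by
  intro x
  rw [Topology.IsInducing.closure_eq_preimage_closure_image (f := Mbar.val) ⟨rfl⟩]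
  refine closure_mono ?_ x.mem
  rintro _ ⟨m, hm, rfl⟩
  exact ⟨_, ⟨⟨m, hm⟩, rfl⟩, rfl⟩

theorem Mbar.isClopen_coord_mem (a : H) (s : Set (N ⧸ conjSub φ M a)) :
    IsClopen {x : Mbar φ M | x.val.coord a ∈ s} :=
  (Nbar.isClopen_coord_mem a s).preimage Mbar.continuous_val

end Completion

section Regular

/-! ### Strong continuity of fields of operators -/

theorem sum_smul_stdBasis {ι : Type*} (ξ : Ell2 ι) (K : Finset ι) (h : ∀ i ∉ K, ξ i = 0) :
    ξ = ∑ i ∈ K, ξ i • stdBasis ι i := by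
  classical
  ext j
  rw [lp.coeFn_sum, Finset.sum_apply]
  simp only [lp.coeFn_smul, Pi.smul_apply, stdBasis_apply, smul_eq_mul, mul_ite, mul_one, mul_zero]
  by_cases hj : j ∈ K
  · simp [hj]
  · simp [hj, h j hj]

/-- Under a uniform norm bound, the vectors on which the field is continuous form a closed subspace,
so it suffices that this subspace contains the basis. -/
theorem continuous_apply_of_continuous_stdBasis {Y ι κ : Type*} [TopologicalSpace Y]
    (A : Y → Ell2 ι →L[ℂ] Ell2 κ) {C : ℝ} (hC : ∀ y, ‖A y‖ ≤ C)
    (h : ∀ i, Continuous fun y => A y (stdBasis ι i)) (ξ : Ell2 ι) :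
    Continuous fun y => A y ξ := by
  let V : Submodule ℂ (Ell2 ι) :=
    { carrier := {ξ | Continuous fun y => A y ξ}
      add_mem' := fun {ξ η} hξ hη => by
        have hξ' : Continuous fun y => A y ξ := hξ
        have hη' : Continuous fun y => A y η := hη
        change Continuous fun y => A y (ξ + η)
        simp only [map_add]
        exact hξ'.add hη'
      zero_mem' := by
        change Continuous fun y => A y 0
        simp only [map_zero]
        exact continuous_const
      smul_mem' := fun c ξ hξ => by
        have hξ' : Continuous fun y => A y ξ := hξ
        change Continuous fun y => A y (c • ξ)
        simp only [map_smul]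
        exact hξ'.const_smul c }
  have hV : IsClosed (V : Set (Ell2 ι)) := by
    refine isClosed_of_closure_subset fun ξ hξ => ?_
    change Continuous fun y => A y ξ
    refine continuous_of_uniform_approx_of_continuous fun u hu => ?_
    obtain ⟨ε, hε, hεu⟩ := Metric.mem_uniformity_dist.1 hu
    obtain ⟨η, hη, hd⟩ := Metric.mem_closure_iff.1 hξ (ε / (|C| + 1)) (by positivity)
    refine ⟨fun y => A y η, hη, fun y => hεu ?_⟩
    rw [dist_eq_norm, ← map_sub]
    refine ((A y).le_opNorm _).trans_lt ?_
    rw [dist_eq_norm] at hd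
    have h1 : ‖A y‖ ≤ |C| + 1 := (hC y).trans ((le_abs_self C).trans (by linarith))
    calc ‖A y‖ * ‖ξ - η‖ ≤ (|C| + 1) * ‖ξ - η‖ := by gcongr
      _ < (|C| + 1) * (ε / (|C| + 1)) := by gcongr
      _ = ε := by field_simp
  have hle : (Submodule.span ℂ (Set.range (stdBasis ι))).topologicalClosure ≤ V := by
    refine Submodule.topologicalClosure_minimal _ (Submodule.span_le.2 ?_) hV
    rintro _ ⟨i, rfl⟩
    exact h i
  rw [(stdBasis ι).dense_span] at hle
  exact hle Submodule.mem_top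

/-- Split A_y ξ_y = A_y(ξ_y − ξ_x) + A_y ξ_x. This is what makes products of bounded strongly
continuous fields strongly continuous. -/
theorem continuous_clm_apply_of_bounded {Y E : Type*} [TopologicalSpace Y]
    [NormedAddCommGroup E] [NormedSpace ℂ E] (A : Y → E →L[ℂ] E) {C : ℝ} (hC : ∀ y, ‖A y‖ ≤ C)
    (hA : ∀ v, Continuous fun y => A y v) {ξ : Y → E} (hξ : Continuous ξ) :
    Continuous fun y => A y (ξ y) := by
  refine continuous_iff_continuousAt.2 fun x => ?_
  have h1 : Filter.Tendsto (fun y => A y (ξ y - ξ x)) (nhds x) (nhds 0) := by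
    refine squeeze_zero_norm (a := fun y => C * ‖ξ y - ξ x‖) (fun y => ?_) ?_
    · exact ((A y).le_opNorm _).trans (by gcongr; exact hC y)
    · have : Continuous fun y => C * ‖ξ y - ξ x‖ := by fun_prop
      simpa using this.tendsto x
  have h2 := h1.add ((hA (ξ x)).tendsto x)
  simpa [ContinuousAt] using h2

variable {N H : Type*} [Group N] [Group H] {φ : H →* MulAut N} {M : Subgroup N}

/-! ### The kernel of a function on the groupoid -/

open Classical in
/-- The function `y ↦ f(y, k)` on the completion, extended by zero. -/
def kernel (f : CompactlySupportedContinuousMap (Arr (Mbar φ M)) ℂ) (k : N ⋊[φ] H)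
    (y : Nbar φ M) : ℂ :=
  if h : y ∈ closure (ofN φ M '' (M : Set N)) ∧ k⁻¹ • y ∈ closure (ofN φ M '' (M : Set N)) then
    f ⟨⟨y, h.1⟩, ⟨k⁻¹ • y, h.2⟩, ⟨k, rfl⟩⟩
  else 0

/-- Extension by zero stays continuous because the set where f(·, k) is defined is clopen. -/
theorem continuous_kernel (hP : ∀ h : H, ∃ a ∈ P φ M, ∃ b ∈ P φ M, h = a * b⁻¹)
    (f : CompactlySupportedContinuousMap (Arr (Mbar φ M)) ℂ) (k : N ⋊[φ] H) :
    Continuous (kernel f k) := by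
  let D : Set (Nbar φ M) := closure (ofN φ M '' (M : Set N)) ∩
    (fun y => k⁻¹ • y) ⁻¹' closure (ofN φ M '' (M : Set N))
  have hD : IsClopen D :=
    (isClopen_closure hP).inter ((isClopen_closure hP).preimage (Nbar.continuous_smul k⁻¹))
  have h1 : ContinuousOn (kernel f k) D := by
    let _ : TopologicalSpace (N ⋊[φ] H) := ⊥
    rw [continuousOn_iff_continuous_domRestrict]
    have : D.domRestrict (kernel f k)
        = fun y : D => f ⟨⟨y, y.2.1⟩, ⟨k⁻¹ • y.1, y.2.2⟩, ⟨k, rfl⟩⟩ :=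
      funext fun y => dif_pos y.2
    rw [this]
    refine f.continuous.comp (continuous_induced_rng.2 ?_)
    exact continuous_subtype_val.prodMk continuous_const
  have h2 : ContinuousOn (kernel f k) Dᶜ :=
    (continuousOn_const (c := (0 : ℂ))).congr fun y hy => dif_neg hy
  rw [← continuousOn_univ, ← Set.union_compl_self D]
  exact h1.union_of_isOpen h2 hD.isOpen hD.compl.isOpen

/-- The compact support of f projects to a compact, hence finite, subset of the discrete group. -/
theorem exists_finset_kernel_eq_zero (f : CompactlySupportedContinuousMap (Arr (Mbar φ M)) ℂ) :
    ∃ K : Finset (N ⋊[φ] H), ∀ k ∉ K, kernel f k = 0 := by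
  let _ : TopologicalSpace (N ⋊[φ] H) := ⊥
  have : DiscreteTopology (N ⋊[φ] H) := ⟨rfl⟩
  have hc : Continuous fun γ : Arr (Mbar φ M) => γ.2.2.1 :=
    continuous_snd.comp (continuous_induced_dom
      (f := fun γ : Arr (Mbar φ M) => ((γ.1.val, γ.2.2.1) : Nbar φ M × (N ⋊[φ] H))))
  have hfin := (f.hasCompactSupport.isCompact.image hc).finite_of_discrete
  refine ⟨hfin.toFinset, fun k hk => funext fun y => ?_⟩
  by_cases h : y ∈ closure (ofN φ M '' (M : Set N)) ∧ k⁻¹ • y ∈ closure (ofN φ M '' (M : Set N))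
  · by_contra h0
    rw [kernel, dif_pos h] at h0
    refine hk (hfin.mem_toFinset.2 ⟨_, subset_tsupport _ h0, rfl⟩)
  · exact dif_neg h

/-- The group element of an arrow in a range fibre. -/
def fiberElt (x : Mbar φ M) (α : RangeFiber x) : N ⋊[φ] H := α.2.1

theorem fiberElt_injective (x : Mbar φ M) : Function.Injective (fiberElt x) := by
  rintro ⟨y, g, hg⟩ ⟨y', g', hg'⟩ h
  change g = g' at h
  subst h
  obtain rfl : y = y' := Mbar.ext (hg.symm.trans hg')
  rfl

theorem mem_range_fiberElt (x : Mbar φ M) (g : N ⋊[φ] H) :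
    g ∈ Set.range (fiberElt x) ↔ g⁻¹ • x.val ∈ closure (ofN φ M '' (M : Set N)) := by
  constructor
  · rintro ⟨⟨y, g, hg⟩, rfl⟩
    change g⁻¹ • x.val ∈ closure (ofN φ M '' (M : Set N))
    rw [hg]
    exact y.mem
  · intro h
    exact ⟨⟨⟨g⁻¹ • x.val, h⟩, (⟨g, rfl⟩ : {k : N ⋊[φ] H // k⁻¹ • x.val = g⁻¹ • x.val})⟩, rfl⟩

theorem apply_invMul (f : CompactlySupportedContinuousMap (Arr (Mbar φ M)) ℂ) {x : Mbar φ M}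
    (α γ : RangeFiber x) :
    f (invMul α γ) = kernel f ((fiberElt x α)⁻¹ * fiberElt x γ) ((fiberElt x α)⁻¹ • x.val) := by
  obtain ⟨⟨y, hy⟩, g, hg⟩ := α
  obtain ⟨⟨z, hz⟩, k, hk⟩ := γ
  change g⁻¹ • x.val = y at hg
  change k⁻¹ • x.val = z at hk
  subst hg
  have he : (g⁻¹ * k)⁻¹ • g⁻¹ • x.val = z := by
    rw [mul_inv_rev, inv_inv, mul_smul, smul_inv_smul, hk]
  subst he
  change f _ = kernel f (g⁻¹ * k) (g⁻¹ • x.val)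
  rw [kernel, dif_pos (And.intro hy hz)]
  rfl

/-! ### The regular representations on the space of the group -/

/-- The component of a bounded family at a unit. -/
def evalHom {X : Type*} [CategoryTheory.Groupoid X] (x : X) :
    RegularProduct X →⋆ₙₐ[ℂ] (Ell2 (RangeFiber x) →L[ℂ] Ell2 (RangeFiber x)) where
  toFun T := T.1 x
  map_smul' _ _ := rfl
  map_zero' := rfl
  map_add' _ _ := rfl
  map_mul' _ _ := rfl
  map_star' _ := rfl

/-- The component of a bounded family at `x`, transported to a corner of the operators on the
`ℓ²` space of the group. -/
def groupRep (x : Mbar φ M) :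
    RegularProduct (Mbar φ M) →⋆ₙₐ[ℂ] (Ell2 (N ⋊[φ] H) →L[ℂ] Ell2 (N ⋊[φ] H)) :=
  (conjHom (push (fiberElt x) (fiberElt_injective x)) (adjoint_push_comp_push _ _)).comp
    (evalHom x)

theorem norm_groupRep (x : Mbar φ M) (T : RegularProduct (Mbar φ M)) :
    ‖groupRep x T‖ = ‖evalHom x T‖ :=
  norm_conjHom _ (adjoint_push_comp_push _ _) _

theorem norm_evalHom_le {X : Type*} [CategoryTheory.Groupoid X] (x : X) (T : RegularProduct X) :
    ‖evalHom x T‖ ≤ ‖T‖ := lp.norm_apply_le_norm (by simp) T x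

theorem continuous_evalHom {X : Type*} [CategoryTheory.Groupoid X] (x : X) :
    Continuous (evalHom x) :=
  AddMonoidHomClass.continuous_of_bound (evalHom x) 1 fun T => by
    rw [one_mul]
    exact norm_evalHom_le x T

theorem norm_groupRep_le (x : Mbar φ M) (T : RegularProduct (Mbar φ M)) :
    ‖groupRep x T‖ ≤ ‖T‖ := (norm_groupRep x T).trans_le (norm_evalHom_le x T)

theorem evalHom_totalRegRep_apply (x : Mbar φ M)
    (f : CompactlySupportedContinuousMap (Arr (Mbar φ M)) ℂ) (α γ : RangeFiber x) :
    (evalHom x (totalRegRep f) (stdBasis _ γ)) α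
      = kernel f ((fiberElt x α)⁻¹ * fiberElt x γ) ((fiberElt x α)⁻¹ • x.val) :=
  (matrixOp_stdBasis _ ((exists_isBandMatrix f).choose_spec x) α γ).trans (apply_invMul f α γ)

/-- Off the range fibre the transported operator vanishes, and so does the zero-extended kernel. One
formula thus covers all g and k, with no reference to the fibre, which varies with x. -/
theorem groupRep_totalRegRep_apply (x : Mbar φ M)
    (f : CompactlySupportedContinuousMap (Arr (Mbar φ M)) ℂ) (g k : N ⋊[φ] H) :
    (groupRep x (totalRegRep f) (stdBasis _ k)) g = kernel f (g⁻¹ * k) (g⁻¹ • x.val) := by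
  have hdef : ∀ v, groupRep x (totalRegRep f) v = push (fiberElt x) (fiberElt_injective x)
      (evalHom x (totalRegRep f) (adjoint (push (fiberElt x) (fiberElt_injective x)) v)) :=
    fun v => rfl
  rw [hdef]
  by_cases hk : k ∈ Set.range (fiberElt x)
  · by_cases hg : g ∈ Set.range (fiberElt x)
    · obtain ⟨γ, rfl⟩ := hk
      obtain ⟨α, rfl⟩ := hg
      rw [adjoint_push_stdBasis, push_apply, evalHom_totalRegRep_apply]
    · rw [push_apply_of_notMem _ _ _ hg, kernel, dif_neg]
      exact fun h => hg ((mem_range_fiberElt x g).2 h.1)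
  · rw [adjoint_push_stdBasis_of_notMem _ _ hk, map_zero, map_zero, kernel, dif_neg]
    · rfl
    · intro h
      refine hk ((mem_range_fiberElt x k).2 ?_)
      have := h.2
      rwa [mul_inv_rev, inv_inv, mul_smul, smul_inv_smul] at this

/-! ### Continuous equivariant fields -/

/-- Left translation by `g` on the `ℓ²` space of the group. -/
abbrev leftTranslation (g : N ⋊[φ] H) : Ell2 (N ⋊[φ] H) →L[ℂ] Ell2 (N ⋊[φ] H) :=
  push (fun k => g * k) (mul_right_injective g)

/-- The family is strongly continuous and equivariant for the arrows of the groupoid. -/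
structure IsContinuousField (T : RegularProduct (Mbar φ M)) : Prop where
  continuous : ∀ ξ, Continuous fun x => groupRep x T ξ
  equivariant : ∀ (x y : Mbar φ M) (g : N ⋊[φ] H), g⁻¹ • x.val = y.val →
    groupRep x T ∘L leftTranslation g = leftTranslation g ∘L groupRep y T

namespace IsContinuousField

variable {T T' : RegularProduct (Mbar φ M)}

theorem add (hT : IsContinuousField T) (hT' : IsContinuousField T') :
    IsContinuousField (T + T') where
  continuous ξ := by
    simp only [map_add, add_apply]
    exact (hT.continuous ξ).add (hT'.continuous ξ)
  equivariant x y g h := by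
    rw [map_add, map_add, add_comp, comp_add, hT.equivariant x y g h, hT'.equivariant x y g h]

theorem zero : IsContinuousField (0 : RegularProduct (Mbar φ M)) where
  continuous ξ := by
    simp only [map_zero, zero_apply]
    exact continuous_const
  equivariant x y g h := by
    rw [map_zero, map_zero, zero_comp, comp_zero]

theorem smul (c : ℂ) (hT : IsContinuousField T) : IsContinuousField (c • T) where
  continuous ξ := by
    simp only [map_smul, smul_apply]
    exact (hT.continuous ξ).const_smul c
  equivariant x y g h := by
    rw [map_smul, map_smul, smul_comp, comp_smul, hT.equivariant x y g h]

theorem mul (hT : IsContinuousField T) (hT' : IsContinuousField T') :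
    IsContinuousField (T * T') where
  continuous ξ := by
    simp only [map_mul]
    exact continuous_clm_apply_of_bounded _ (fun x => norm_groupRep_le x T) hT.continuous
      (hT'.continuous ξ)
  equivariant x y g h := by
    rw [map_mul, map_mul, mul_def, mul_def, comp_assoc, hT'.equivariant x y g h, ← comp_assoc,
      hT.equivariant x y g h, comp_assoc]

theorem of_kernel (κ : N ⋊[φ] H → Nbar φ M → ℂ) (hκ : ∀ k, Continuous (κ k))
    {K : Finset (N ⋊[φ] H)} (hK : ∀ k ∉ K, κ k = 0)
    (h : ∀ x g k, (groupRep x T (stdBasis _ k)) g = κ (g⁻¹ * k) (g⁻¹ • x.val)) :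
    IsContinuousField T where
  continuous ξ := by
    classical
    refine continuous_apply_of_continuous_stdBasis _ (fun x => norm_groupRep_le x T)
      (fun k => ?_) ξ
    -- The column at k is supported in kK⁻¹, a finite set independent of x, so strong continuity
    -- reduces to continuity of finitely many entries.
    have he : ∀ x, groupRep x T (stdBasis _ k)
        = ∑ g ∈ K.image fun c => k * c⁻¹, κ (g⁻¹ * k) (g⁻¹ • x.val) • stdBasis _ g := fun x => by
      simp only [← h]
      refine sum_smul_stdBasis _ _ fun g hg => ?_
      rw [h, hK]
      · rfl
      · exact fun hc => hg (Finset.mem_image.2 ⟨_, hc, by group⟩)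
    simp only [he]
    refine continuous_finsetSum _ fun g _ => ?_
    exact ((hκ _).comp ((Nbar.continuous_smul _).comp Mbar.continuous_val)).smul continuous_const
  equivariant x y g hg := by
    refine op_ext fun k => ?_
    ext c
    obtain ⟨c, rfl⟩ : ∃ c', g * c' = c := ⟨g⁻¹ * c, by group⟩
    rw [comp_apply, comp_apply, push_stdBasis, h]
    rw [push_apply (fun k => g * k) (mul_right_injective g), h, ← hg]
    rw [mul_inv_rev, mul_smul, mul_assoc, inv_mul_cancel_left]

theorem totalRegRep (hP : ∀ h : H, ∃ a ∈ P φ M, ∃ b ∈ P φ M, h = a * b⁻¹)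
    (f : CompactlySupportedContinuousMap (Arr (Mbar φ M)) ℂ) :
    IsContinuousField (totalRegRep f) := by
  obtain ⟨K, hK⟩ := exists_finset_kernel_eq_zero f
  exact of_kernel (kernel f) (continuous_kernel hP f) hK
    fun x g k => groupRep_totalRegRep_apply x f g k

theorem star_totalRegRep (hP : ∀ h : H, ∃ a ∈ P φ M, ∃ b ∈ P φ M, h = a * b⁻¹)
    (f : CompactlySupportedContinuousMap (Arr (Mbar φ M)) ℂ) :
    IsContinuousField (star (CuntzLi.totalRegRep f)) := by
  classical
  obtain ⟨K, hK⟩ := exists_finset_kernel_eq_zero f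
  -- The adjoint matrix again has kernel form, with the kernel of the groupoid involution f*(γ) =
  -- conj f(γ⁻¹).
  refine of_kernel (fun k y => star (kernel f k⁻¹ (k⁻¹ • y)))
    (fun k => continuous_star.comp ((continuous_kernel hP f k⁻¹).comp (Nbar.continuous_smul k⁻¹)))
    (K := K.image Inv.inv) (fun k hk => ?_) fun x g k => ?_
  · have : k⁻¹ ∉ K := fun h => hk (Finset.mem_image.2 ⟨_, h, inv_inv k⟩)
    ext y
    simp [hK _ this]
  · rw [map_star, star_eq_adjoint, adjoint_apply_stdBasis, groupRep_totalRegRep_apply, ← mul_smul]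
    congr 3 <;> group

end IsContinuousField

/-! ### The reduced norm is attained at the identity -/

/-- Strong continuity does not pass to adjoints in general, so the induction carries T and its star
together. -/
theorem isContinuousField_of_mem_adjoin
    (hP : ∀ h : H, ∃ a ∈ P φ M, ∃ b ∈ P φ M, h = a * b⁻¹) {T : RegularProduct (Mbar φ M)}
    (hT : T ∈ NonUnitalStarAlgebra.adjoin ℂ (Set.range (totalRegRep (X := Mbar φ M)))) :
    IsContinuousField T ∧ IsContinuousField (star T) := by
  induction hT using NonUnitalStarAlgebra.adjoin_induction with
  | mem T h =>
    obtain ⟨f, rfl⟩ := h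
    exact ⟨.totalRegRep hP f, .star_totalRegRep hP f⟩
  | add T T' _ _ h h' => exact ⟨h.1.add h'.1, by rw [star_add]; exact h.2.add h'.2⟩
  | zero => exact ⟨.zero, by rw [star_zero]; exact .zero⟩
  | mul T T' _ _ h h' => exact ⟨h.1.mul h'.1, by rw [star_mul]; exact h'.2.mul h.2⟩
  | smul c T _ h => exact ⟨h.1.smul c, by rw [star_smul]; exact h.2.smul _⟩
  | star T _ h => exact ⟨h.2, by rw [star_star]; exact h.1⟩

theorem IsContinuousField.norm_groupRep_ofM_le {T : RegularProduct (Mbar φ M)}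
    (hT : IsContinuousField T) (m : M) :
    ‖groupRep (Mbar.ofM φ M m) T‖ ≤ ‖groupRep (Mbar.ofM φ M 1) T‖ := by
  -- The group element m⁻¹ gives an arrow with range the identity and source m, so the operator at m
  -- is λ* T λ, with T the operator at the identity and λ a translation isometry.
  have h := hT.equivariant (Mbar.ofM φ M 1) (Mbar.ofM φ M m) (SemidirectProduct.inl (m : N)⁻¹) (by
    change _ • ofN φ M _ = ofN φ M _
    rw [smul_ofN]
    simp)
  have h1 := congrArg (fun A => adjoint (leftTranslation
    (SemidirectProduct.inl (m : N)⁻¹ : N ⋊[φ] H)) ∘L A) h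
  simp only [← comp_assoc, adjoint_push_comp_push] at h1
  rw [show groupRep (Mbar.ofM φ M m) T = 1 ∘L groupRep (Mbar.ofM φ M m) T from rfl, ← h1]
  have hn : ‖leftTranslation (SemidirectProduct.inl (m : N)⁻¹ : N ⋊[φ] H)‖ ≤ 1 :=
    LinearIsometry.norm_toContinuousLinearMap_le _
  refine (opNorm_comp_le _ _).trans ?_
  refine (mul_le_of_le_one_right (norm_nonneg _) hn).trans ?_
  refine (opNorm_comp_le _ _).trans ?_
  rw [LinearIsometryEquiv.norm_map]
  exact mul_le_of_le_one_left (norm_nonneg _) hn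

/-- For each fixed ξ, the bound by the norm at the identity is a closed condition on the unit and
holds on the dense subset M. -/
theorem IsContinuousField.norm_le {T : RegularProduct (Mbar φ M)} (hT : IsContinuousField T) :
    ‖T‖ ≤ ‖evalHom (Mbar.ofM φ M 1) T‖ := by
  refine lp.norm_le_of_forall_le (norm_nonneg _) fun x => ?_
  change ‖evalHom x T‖ ≤ _
  rw [← norm_groupRep, ← norm_groupRep]
  refine opNorm_le_bound _ (norm_nonneg _) fun ξ => ?_
  have hcl : IsClosed {y | ‖groupRep y T ξ‖ ≤ ‖groupRep (Mbar.ofM φ M 1) T‖ * ‖ξ‖} :=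
    isClosed_le (hT.continuous ξ).norm continuous_const
  refine closure_minimal ?_ hcl (Mbar.denseRange_ofM x)
  rintro _ ⟨m, rfl⟩
  refine (le_opNorm _ _).trans ?_
  gcongr
  exact hT.norm_groupRep_ofM_le m

theorem norm_le_of_mem_reducedCStar
    (hP : ∀ h : H, ∃ a ∈ P φ M, ∃ b ∈ P φ M, h = a * b⁻¹) {T : RegularProduct (Mbar φ M)}
    (hT : T ∈ ReducedCStar (Mbar φ M)) : ‖T‖ ≤ ‖evalHom (Mbar.ofM φ M 1) T‖ := by
  refine closure_minimal (fun S hS => ?_) (isClosed_le continuous_norm (continuous_evalHom _).norm) hT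
  exact (isContinuousField_of_mem_adjoin hP hS).1.norm_le

end Regular

section Corner

variable {N H : Type*} [Group N] [Group H] (φ : H →* MulAut N) (M : Subgroup N)

/-! ### Compressions of left translations -/

/-- The inclusion of `M × H` into the semidirect product. -/
def pairElt (p : M × H) : N ⋊[φ] H := ⟨p.1, p.2⟩

theorem pairElt_injective : Function.Injective (pairElt φ M) := by
  rintro ⟨⟨m, hm⟩, b⟩ ⟨⟨m', hm'⟩, b'⟩ h
  obtain ⟨h1, h2⟩ := SemidirectProduct.ext_iff.1 h
  change m = m' at h1
  change b = b' at h2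
  subst h1 h2
  rfl

variable {φ M}

theorem mem_range_pairElt {g : N ⋊[φ] H} : g ∈ Set.range (pairElt φ M) ↔ g.left ∈ M :=
  ⟨by rintro ⟨p, rfl⟩; exact p.1.2, fun h => ⟨(⟨g.left, h⟩, g.right), rfl⟩⟩

theorem inl_mul_pairElt (m : M) (p : M × H) :
    (SemidirectProduct.inl (m : N) : N ⋊[φ] H) * pairElt φ M p = pairElt φ M (m * p.1, p.2) := by
  refine SemidirectProduct.ext ?_ ?_
  · change (m : N) * φ 1 p.1 = m * p.1
    simp
  · exact one_mul _

theorem inr_mul_pairElt (a : P φ M) (p : M × H) :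
    (SemidirectProduct.inr (a : H) : N ⋊[φ] H) * pairElt φ M p
      = pairElt φ M (⟨φ (a : H) p.1, conj_mem a.2 p.1.2⟩, a * p.2) :=
  SemidirectProduct.ext (one_mul _) rfl

variable (M) in
/-- The compression of the left translation by `k` to `ℓ²(M × H)`. -/
def compress (k : N ⋊[φ] H) : Ell2 (M × H) →L[ℂ] Ell2 (M × H) :=
  adjoint (push (pairElt φ M) (pairElt_injective φ M)) ∘L leftTranslation k ∘L
    push (pairElt φ M) (pairElt_injective φ M)

theorem compress_stdBasis (k : N ⋊[φ] H) (p : M × H) :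
    compress M k (stdBasis _ p) = adjoint (push (pairElt φ M) (pairElt_injective φ M))
      (stdBasis _ (k * pairElt φ M p)) := by
  rw [compress, comp_apply, comp_apply, push_stdBasis, push_stdBasis]

theorem compress_stdBasis_of_eq {k : N ⋊[φ] H} {p q : M × H}
    (h : k * pairElt φ M p = pairElt φ M q) :
    compress M k (stdBasis _ p) = stdBasis _ q := by
  rw [compress_stdBasis, h, adjoint_push_stdBasis]

theorem compress_stdBasis_of_notMem {k : N ⋊[φ] H} {p : M × H}
    (h : k * pairElt φ M p ∉ Set.range (pairElt φ M)) : compress M k (stdBasis _ p) = 0 := by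
  rw [compress_stdBasis, adjoint_push_stdBasis_of_notMem _ _ h]

open Classical in
theorem compress_stdBasis_apply (k : N ⋊[φ] H) (p q : M × H) :
    (compress M k (stdBasis _ p)) q = if k = pairElt φ M q * (pairElt φ M p)⁻¹ then 1 else 0 := by
  rw [compress_stdBasis, adjoint_push_apply]
  exact (stdBasis_apply _ _).trans (if_congr eq_mul_inv_iff_mul_eq.symm rfl rfl)

theorem adjoint_compress (k : N ⋊[φ] H) : adjoint (compress M k) = compress M k⁻¹ := by
  classical
  refine op_ext fun p => ?_
  ext q
  rw [adjoint_apply_stdBasis, compress_stdBasis_apply, compress_stdBasis_apply,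
    apply_ite star, star_one, star_zero]
  refine if_congr ?_ rfl rfl
  rw [inv_eq_iff_eq_inv, mul_inv_rev, inv_inv]

/-- Compressions are not multiplicative in general. Here translation by l preserves ℓ²(M × H), so
the projection between the two factors does nothing. -/
theorem compress_comp_of_right {k l : N ⋊[φ] H}
    (hl : ∀ p, l * pairElt φ M p ∈ Set.range (pairElt φ M)) :
    compress M k ∘L compress M l = compress M (k * l) :=
  op_ext fun p => by
    obtain ⟨q, hq⟩ := hl p
    rw [comp_apply, compress_stdBasis_of_eq hq.symm, compress_stdBasis, compress_stdBasis, hq,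
      mul_assoc]

theorem compress_comp_of_left {k l : N ⋊[φ] H}
    (hk : ∀ p, k⁻¹ * pairElt φ M p ∈ Set.range (pairElt φ M)) :
    compress M k ∘L compress M l = compress M (k * l) := by
  have h := congrArg adjoint (compress_comp_of_right (k := l⁻¹) hk)
  rwa [adjoint_comp, adjoint_compress, adjoint_compress, adjoint_compress, inv_inv, inv_inv,
    mul_inv_rev, inv_inv, inv_inv] at h

theorem inl_mul_pairElt_mem (m : M) (p : M × H) :
    (SemidirectProduct.inl (m : N) : N ⋊[φ] H) * pairElt φ M p ∈ Set.range (pairElt φ M) :=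
  ⟨_, (inl_mul_pairElt m p).symm⟩

theorem inr_mul_pairElt_mem (a : P φ M) (p : M × H) :
    (SemidirectProduct.inr (a : H) : N ⋊[φ] H) * pairElt φ M p ∈ Set.range (pairElt φ M) :=
  ⟨_, (inr_mul_pairElt a p).symm⟩

theorem compress_inl (m : M) :
    compress M (SemidirectProduct.inl (m : N) : N ⋊[φ] H) = U M m :=
  op_ext fun p => by
    rw [compress_stdBasis_of_eq (inl_mul_pairElt m p)]
    exact (U_stdBasis M m p.1 p.2).symm

theorem compress_inr (a : P φ M) :
    compress M (SemidirectProduct.inr (a : H) : N ⋊[φ] H) = S φ M a :=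
  op_ext fun p => by
    rw [compress_stdBasis_of_eq (inr_mul_pairElt a p)]
    exact (S_stdBasis φ M a p.1 p.2).symm

theorem compress_inl_mem (m : M) :
    compress M (SemidirectProduct.inl (m : N) : N ⋊[φ] H) ∈ RegularAlgebra φ M := by
  rw [compress_inl]
  exact StarSubalgebra.le_topologicalClosure _ (StarAlgebra.subset_adjoin ℂ _ (Or.inr ⟨m, rfl⟩))

theorem compress_inr_mem (a : P φ M) :
    compress M (SemidirectProduct.inr (a : H) : N ⋊[φ] H) ∈ RegularAlgebra φ M := by
  rw [compress_inr]
  exact StarSubalgebra.le_topologicalClosure _ (StarAlgebra.subset_adjoin ℂ _ (Or.inl ⟨a, rfl⟩))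

theorem compress_inv_mem {k : N ⋊[φ] H} (hk : compress M k ∈ RegularAlgebra φ M) :
    compress M k⁻¹ ∈ RegularAlgebra φ M := by
  rw [← adjoint_compress, ← star_eq_adjoint]
  exact star_mem hk

theorem compress_mem (hP : ∀ h : H, ∃ a ∈ P φ M, ∃ b ∈ P φ M, h = a⁻¹ * b) (k : N ⋊[φ] H) :
    compress M k ∈ RegularAlgebra φ M := by
  by_cases h : ∃ p q, k * pairElt φ M p = pairElt φ M q
  · obtain ⟨p, q, h⟩ := h
    obtain ⟨a, ha, b, hb, hab⟩ := hP (q.2 * p.2⁻¹)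
    have hpair : ∀ p : M × H, pairElt φ M p
        = SemidirectProduct.inl (p.1 : N) * SemidirectProduct.inr p.2 :=
      fun p => SemidirectProduct.mk_eq_inl_mul_inr _ _
    -- A nonzero compression forces k = qp⁻¹. With its H-part written a⁻¹b, each product can be
    -- split: the rightmost factor preserves M × H, and the factors peeled off on the left have
    -- inverses that do.
    have hk : k = SemidirectProduct.inl (q.1 : N) * ((SemidirectProduct.inr a)⁻¹ *
        (SemidirectProduct.inr b * SemidirectProduct.inl ((p.1⁻¹ : M) : N))) := by
      rw [← mul_assoc (SemidirectProduct.inr a)⁻¹, ← map_inv, ← map_mul, ← hab,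
        eq_mul_inv_of_mul_eq h, hpair, hpair, map_mul, map_inv, Subgroup.coe_inv, map_inv]
      group
    rw [hk, ← compress_comp_of_left, ← compress_comp_of_left, ← compress_comp_of_right]
    · refine mul_mem (compress_inl_mem _) (mul_mem ?_ (mul_mem ?_ (compress_inl_mem _)))
      · exact compress_inv_mem (compress_inr_mem ⟨a, ha⟩)
      · exact compress_inr_mem ⟨b, hb⟩
    · exact inl_mul_pairElt_mem _
    · rw [inv_inv]
      exact inr_mul_pairElt_mem ⟨a, ha⟩
    · rw [← map_inv, ← Subgroup.coe_inv]
      exact inl_mul_pairElt_mem _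
  · have : compress M k = 0 := op_ext fun p => by
      rw [compress_stdBasis_of_notMem]
      · rfl
      · rintro ⟨q, hq⟩
        exact h ⟨p, q, hq.symm⟩
    rw [this]
    exact zero_mem _

/-! ### Diagonal operators -/

/-- For c in P this describes the range of U(m)S_c: the basis vectors whose M-component lies in the
coset m(cMc⁻¹). -/
theorem inr_inv_mul_inl_inv_mul_pairElt_mem_iff (c : H) (m : M) (p : M × H) :
    (SemidirectProduct.inl (m : N) * SemidirectProduct.inr c : N ⋊[φ] H)⁻¹ * pairElt φ M p
      ∈ Set.range (pairElt φ M) ↔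
    (p.1 : N ⧸ conjSub φ M c) = ((m : N) : N ⧸ conjSub φ M c) := by
  rw [mem_range_pairElt, eq_comm, QuotientGroup.eq, mem_conjSub, mul_inv_rev, mul_assoc,
    ← map_inv, ← map_inv, ← Subgroup.coe_inv, inl_mul_pairElt]
  change (1 : N) * φ c⁻¹ ((m⁻¹ * p.1 : M) : N) ∈ M ↔ _
  rw [one_mul]
  constructor
  · refine fun h => ⟨_, h, ?_⟩
    rw [← MulAut.mul_apply, ← map_mul, mul_inv_cancel, map_one]
    rfl
  · rintro ⟨n, hn, h⟩
    rw [Subgroup.coe_mul, ← h, ← MulAut.mul_apply, ← map_mul, inv_mul_cancel, map_one]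
    exact hn

variable (φ M) in
/-- The indicator function of the closure of the coset `m(cMc⁻¹)`. -/
def cosetIndicator (c : H) (m : M) : C(Mbar φ M, ℂ) where
  toFun := Set.indicator
    {x : Mbar φ M | x.val.coord c ∈ ({((m : N) : N ⧸ conjSub φ M c)} : Set _)} fun _ => 1
  continuous_toFun := (Mbar.isClopen_coord_mem c _).continuous_indicator continuous_const

theorem cosetIndicator_of_eq {c : H} {m : M} {x : Mbar φ M}
    (h : x.val.coord c = ((m : N) : N ⧸ conjSub φ M c)) : cosetIndicator φ M c m x = 1 :=
  Set.indicator_of_mem (s := {x : Mbar φ M | x.val.coord c ∈ ({_} : Set _)}) h fun _ => (1 : ℂ)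

theorem cosetIndicator_of_ne {c : H} {m : M} {x : Mbar φ M}
    (h : x.val.coord c ≠ ((m : N) : N ⧸ conjSub φ M c)) : cosetIndicator φ M c m x = 0 :=
  Set.indicator_of_notMem (s := {x : Mbar φ M | x.val.coord c ∈ ({_} : Set _)}) h fun _ => (1 : ℂ)

section Diagonal

variable [CompactSpace (Mbar φ M)]

open Classical in
/-- The matrix of the multiplication by a continuous function on the closure of `M`. -/
theorem isBandMatrix_diagonal (F : C(Mbar φ M, ℂ)) :
    IsBandMatrix (fun p q : M × H => if p = q then F (Mbar.ofM φ M p.1) else 0) 1 ‖F‖ where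
  nonneg := norm_nonneg F
  bound p q := by
    split_ifs
    · exact F.norm_coe_le_norm _
    · simp
  row p := by
    rw [Nat.cast_one, Set.encard_le_one_iff]
    intro q q' hq hq'
    rw [← (ite_ne_right_iff.1 hq).1, ← (ite_ne_right_iff.1 hq').1]
  col q := by
    rw [Nat.cast_one, Set.encard_le_one_iff]
    intro p p' hp hp'
    rw [(ite_ne_right_iff.1 hp).1, (ite_ne_right_iff.1 hp').1]

/-- The multiplication by a continuous function on the closure of `M`. -/
def diagonalOp (F : C(Mbar φ M, ℂ)) : Ell2 (M × H) →L[ℂ] Ell2 (M × H) :=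
  matrixOp _ (isBandMatrix_diagonal F)

theorem diagonalOp_apply (F : C(Mbar φ M, ℂ)) (ξ : Ell2 (M × H)) (p : M × H) :
    (diagonalOp F ξ) p = F (Mbar.ofM φ M p.1) * ξ p := by
  refine (matrixOp_apply _ _ _ _).trans ?_
  rw [tsum_eq_single p]
  · rw [if_pos rfl]
  · intro q hq
    rw [if_neg hq.symm, zero_mul]

theorem diagonalOp_stdBasis (F : C(Mbar φ M, ℂ)) (p : M × H) :
    diagonalOp F (stdBasis _ p) = F (Mbar.ofM φ M p.1) • stdBasis _ p := by
  ext q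
  rw [diagonalOp_apply]
  change _ = F (Mbar.ofM φ M p.1) * (stdBasis _ p) q
  by_cases h : p = q
  · rw [h]
  · rw [stdBasis_apply_ne h, mul_zero, mul_zero]

variable (φ M) in
/-- The representation of the continuous functions on the closure of `M` by multiplication. -/
def diagonalHom : C(Mbar φ M, ℂ) →⋆ₐ[ℂ] (Ell2 (M × H) →L[ℂ] Ell2 (M × H)) where
  toFun := diagonalOp
  map_one' := op_ext fun p => by
    rw [diagonalOp_stdBasis]
    exact one_smul _ _
  map_mul' F G := op_ext fun p => by
    rw [mul_def, comp_apply, diagonalOp_stdBasis, diagonalOp_stdBasis, map_smul, diagonalOp_stdBasis,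
      smul_smul, ContinuousMap.mul_apply, mul_comm]
  map_zero' := op_ext fun p => by
    rw [diagonalOp_stdBasis]
    exact zero_smul _ _
  map_add' F G := op_ext fun p => by
    rw [add_apply, diagonalOp_stdBasis, diagonalOp_stdBasis, diagonalOp_stdBasis,
      ContinuousMap.add_apply, add_smul]
  commutes' c := op_ext fun p => by
    rw [diagonalOp_stdBasis]
    simp [Algebra.algebraMap_eq_smul_one]
  map_star' F := op_ext fun p => by
    ext q
    rw [star_eq_adjoint, adjoint_apply_stdBasis, diagonalOp_apply, diagonalOp_apply, star_mul']
    by_cases h : p = q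
    · rw [h, stdBasis_apply_self, star_one]
      rfl
    · rw [stdBasis_apply_ne h, stdBasis_apply_ne (Ne.symm h), star_zero, mul_zero, mul_zero]

theorem continuous_diagonalHom : Continuous (diagonalHom φ M) := by
  open scoped CStarAlgebra in exact map_continuous (diagonalHom φ M)

theorem diagonalOp_cosetIndicator_mem {c : H} (hc : c ∈ P φ M) (m : M) :
    diagonalOp (cosetIndicator φ M c m) ∈ RegularAlgebra φ M := by
  have hk : compress M (SemidirectProduct.inl (m : N) * SemidirectProduct.inr c : N ⋊[φ] H)
      ∈ RegularAlgebra φ M := by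
    rw [← compress_comp_of_right (inr_mul_pairElt_mem ⟨c, hc⟩)]
    exact mul_mem (compress_inl_mem m) (compress_inr_mem ⟨c, hc⟩)
  -- The indicator acts as the range projection VV* of the isometry V = U(m)S_c.
  convert mul_mem hk (compress_inv_mem hk) using 1
  refine op_ext fun p => ?_
  rw [diagonalOp_stdBasis, mul_def, comp_apply]
  by_cases h : (p.1 : N ⧸ conjSub φ M c) = ((m : N) : N ⧸ conjSub φ M c)
  · obtain ⟨q, hq⟩ := (inr_inv_mul_inl_inv_mul_pairElt_mem_iff c m p).2 h
    rw [cosetIndicator_of_eq h, one_smul, compress_stdBasis_of_eq hq.symm,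
      compress_stdBasis_of_eq (q := p)]
    rw [hq, mul_inv_cancel_left]
  · rw [cosetIndicator_of_ne h, zero_smul, compress_stdBasis_of_notMem, map_zero]
    exact fun hq => h ((inr_inv_mul_inl_inv_mul_pairElt_mem_iff c m p).1 hq)

/-- Stone–Weierstrass applied to the functions whose multiplication operator lies in the algebra.
They form a closed *-subalgebra, and coset indicators separate points once a separating coordinate
is refined to one in P. -/
theorem diagonalOp_mem (hP : ∀ h : H, ∃ a ∈ P φ M, ∃ b ∈ P φ M, h = a * b⁻¹)
    (F : C(Mbar φ M, ℂ)) : diagonalOp F ∈ RegularAlgebra φ M := by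
  let A : StarSubalgebra ℂ C(Mbar φ M, ℂ) := (RegularAlgebra φ M).comap (diagonalHom φ M)
  have hA : A.SeparatesPoints := by
    intro x y hxy
    obtain ⟨a, ha⟩ : ∃ a, x.val.coord a ≠ y.val.coord a := by
      by_contra! h
      exact hxy (Mbar.ext (Nbar.ext (funext h)))
    obtain ⟨c, hc, hle⟩ := exists_conjSub_le hP {a}
    have hca : y.val.coord c ≠ x.val.coord c := fun h => ha (by
      rw [← x.val.compat c a (hle a (Finset.mem_singleton_self a)),
        ← y.val.compat c a (hle a (Finset.mem_singleton_self a)), h])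
    obtain ⟨m, hm, h⟩ := Nbar.exists_mem_coord_eq x.mem c
    refine ⟨_, ⟨cosetIndicator φ M c ⟨m, hm⟩, diagonalOp_cosetIndicator_mem hc _, rfl⟩, ?_⟩
    change cosetIndicator φ M c ⟨m, hm⟩ x ≠ cosetIndicator φ M c ⟨m, hm⟩ y
    rw [cosetIndicator_of_eq (m := ⟨m, hm⟩) h, cosetIndicator_of_ne (m := ⟨m, hm⟩) (h ▸ hca)]
    exact one_ne_zero
  have hclosed : IsClosed (A : Set C(Mbar φ M, ℂ)) :=
    (StarSubalgebra.isClosed_topologicalClosure _).preimage continuous_diagonalHom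
  have htop := ContinuousMap.starSubalgebra_topologicalClosure_eq_top_of_separatesPoints A hA
  have hF : F ∈ A.topologicalClosure := htop ▸ StarSubalgebra.mem_top
  have hF' : F ∈ closure (A : Set C(Mbar φ M, ℂ)) := hF
  rw [hclosed.closure_eq] at hF'
  exact hF'

end Diagonal

end Corner

section Main

variable {N H : Type*} [Group N] [Group H] {φ : H →* MulAut N} {M : Subgroup N}

/-! ### The regular representation at the identity -/

theorem inv_pairElt_mem (p : M × H) :
    (pairElt φ M p)⁻¹ ∈ Set.range (fiberElt (Mbar.ofM φ M 1)) := by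
  rw [mem_range_fiberElt, inv_inv]
  refine subset_closure ⟨p.1, p.1.2, ?_⟩
  change _ = _ • ofN φ M _
  rw [smul_ofN]
  simp [pairElt]

variable (φ M) in
/-- The arrow with range the identity of `N̄` and group element `(mb)⁻¹`. -/
def pairArrow (p : M × H) : RangeFiber (Mbar.ofM φ M 1) := (inv_pairElt_mem p).choose

theorem fiberElt_pairArrow (p : M × H) :
    fiberElt _ (pairArrow φ M p) = (pairElt φ M p)⁻¹ := (inv_pairElt_mem p).choose_spec

theorem pairArrow_bijective (hP : ∀ h : H, ∃ a ∈ P φ M, ∃ b ∈ P φ M, h = a * b⁻¹) :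
    Function.Bijective (pairArrow φ M) := by
  constructor
  · intro p q h
    have := congrArg (fiberElt _) h
    rw [fiberElt_pairArrow, fiberElt_pairArrow] at this
    exact pairElt_injective φ M (inv_injective this)
  · intro α
    have h := (mem_range_fiberElt _ _).1 ⟨α, rfl⟩
    change _ • ofN φ M _ ∈ _ at h
    -- This is where surjectivity needs that an element of N in the closure of M already lies in M.
    rw [smul_ofN, ofN_mem_closure_iff hP] at h
    have h' : (fiberElt _ α)⁻¹ ∈ Set.range (pairElt φ M) := by
      rw [mem_range_pairElt]
      simpa using h
    obtain ⟨p, hp⟩ := h'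
    refine ⟨p, fiberElt_injective _ ?_⟩
    rw [fiberElt_pairArrow, hp, inv_inv]

/-- The regular representation at the identity, as a representation on `ℓ²(M × H)`. -/
def cornerRep (hP : ∀ h : H, ∃ a ∈ P φ M, ∃ b ∈ P φ M, h = a * b⁻¹) :
    RegularProduct (Mbar φ M) →⋆ₙₐ[ℂ] (Ell2 (M × H) →L[ℂ] Ell2 (M × H)) :=
  (conjHom (adjoint (push (pairArrow φ M) (pairArrow_bijective hP).1)) (by
    rw [adjoint_adjoint]
    exact push_comp_adjoint_push _ (pairArrow_bijective hP))).comp (evalHom (Mbar.ofM φ M 1))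

variable (hP : ∀ h : H, ∃ a ∈ P φ M, ∃ b ∈ P φ M, h = a * b⁻¹)

theorem norm_cornerRep (T : RegularProduct (Mbar φ M)) :
    ‖cornerRep hP T‖ = ‖evalHom (Mbar.ofM φ M 1) T‖ :=
  norm_conjHom _ (by
    rw [adjoint_adjoint]
    exact push_comp_adjoint_push _ (pairArrow_bijective hP)) _

theorem cornerRep_totalRegRep_apply (f : CompactlySupportedContinuousMap (Arr (Mbar φ M)) ℂ)
    (p q : M × H) : (cornerRep hP (totalRegRep f) (stdBasis _ p)) q
      = kernel f (pairElt φ M q * (pairElt φ M p)⁻¹) (ofN φ M q.1) := by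
  have hdef : ∀ v, cornerRep hP (totalRegRep f) v
      = adjoint (push (pairArrow φ M) (pairArrow_bijective hP).1)
        (evalHom _ (totalRegRep f) (adjoint (adjoint
          (push (pairArrow φ M) (pairArrow_bijective hP).1)) v)) := fun v => rfl
  rw [hdef, adjoint_adjoint, push_stdBasis, adjoint_push_apply, evalHom_totalRegRep_apply,
    fiberElt_pairArrow, fiberElt_pairArrow, inv_inv]
  change kernel f _ (_ • ofN φ M _) = _
  rw [smul_ofN]
  simp [pairElt]

/-- The entry at (q, p) only sees k = qp⁻¹, so sorting the matrix by k splits it into diagonal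
operators times compressed translations. -/
theorem cornerRep_totalRegRep_eq_sum [CompactSpace (Mbar φ M)]
    (f : CompactlySupportedContinuousMap (Arr (Mbar φ M)) ℂ) {K : Finset (N ⋊[φ] H)}
    (hK : ∀ k ∉ K, kernel f k = 0) :
    cornerRep hP (totalRegRep f) = ∑ k ∈ K, diagonalOp ⟨fun x => kernel f k x.val,
      (continuous_kernel hP f k).comp Mbar.continuous_val⟩ * compress M k := by
  classical
  refine op_ext fun p => ?_
  ext q
  rw [cornerRep_totalRegRep_apply, sum_apply, lp.coeFn_sum, Finset.sum_apply]
  simp only [mul_def, comp_apply, diagonalOp_apply, compress_stdBasis_apply, mul_ite, mul_one,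
    mul_zero, Finset.sum_ite_eq']
  split_ifs with h
  · rfl
  · rw [hK _ h]
    rfl

theorem cornerRep_totalRegRep_mem [CompactSpace (Mbar φ M)]
    (hP' : ∀ h : H, ∃ a ∈ P φ M, ∃ b ∈ P φ M, h = a⁻¹ * b)
    (f : CompactlySupportedContinuousMap (Arr (Mbar φ M)) ℂ) :
    cornerRep hP (totalRegRep f) ∈ RegularAlgebra φ M := by
  obtain ⟨K, hK⟩ := exists_finset_kernel_eq_zero f
  rw [cornerRep_totalRegRep_eq_sum hP f hK]
  exact sum_mem fun k _ => mul_mem (diagonalOp_mem hP _) (compress_mem hP' k)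

theorem continuous_cornerRep : Continuous (cornerRep hP) :=
  AddMonoidHomClass.continuous_of_bound (cornerRep hP) 1 fun T => by
    rw [one_mul, norm_cornerRep]
    exact norm_evalHom_le _ T

theorem cornerRep_mem [CompactSpace (Mbar φ M)]
    (hP' : ∀ h : H, ∃ a ∈ P φ M, ∃ b ∈ P φ M, h = a⁻¹ * b) {T : RegularProduct (Mbar φ M)}
    (hT : T ∈ ReducedCStar (Mbar φ M)) : cornerRep hP T ∈ RegularAlgebra φ M := by
  have hle : NonUnitalStarAlgebra.adjoin ℂ (Set.range (totalRegRep (X := Mbar φ M)))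
      ≤ (RegularAlgebra φ M).toNonUnitalStarSubalgebra.comap (cornerRep hP) := by
    refine NonUnitalStarAlgebra.adjoin_le ?_
    rintro _ ⟨f, rfl⟩
    exact cornerRep_totalRegRep_mem hP hP' f
  have hcl : IsClosed (cornerRep hP ⁻¹' (RegularAlgebra φ M : Set _)) :=
    (StarSubalgebra.isClosed_topologicalClosure _).preimage (continuous_cornerRep hP)
  exact closure_minimal (fun S hS => hle hS) hcl hT

/-! ### The image of the reduced C*-algebra -/

/-- The set is a copy of the intersection of the closure of M with its translate by k, closed in a
compact set. -/
theorem isCompact_elt_eq [CompactSpace (Mbar φ M)]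
    (hP : ∀ h : H, ∃ a ∈ P φ M, ∃ b ∈ P φ M, h = a * b⁻¹) (k : N ⋊[φ] H) :
    IsCompact {γ : Arr (Mbar φ M) | γ.2.2.1 = k} := by
  let _ : TopologicalSpace (N ⋊[φ] H) := ⊥
  have hind : Topology.IsInducing
      (fun γ : Arr (Mbar φ M) => ((γ.1.val, γ.2.2.1) : Nbar φ M × (N ⋊[φ] H))) := ⟨rfl⟩
  rw [hind.isCompact_iff]
  have hcl : IsCompact (closure (ofN φ M '' (M : Set N))) := by
    rw [← Mbar.range_val]
    exact isCompact_range Mbar.continuous_val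
  have hD := hcl.inter_right ((isClopen_closure hP).1.preimage (Nbar.continuous_smul k⁻¹))
  convert hD.prod (isCompact_singleton (x := k)) using 1
  ext ⟨y, g⟩
  constructor
  · rintro ⟨γ, hγ, h⟩
    obtain ⟨rfl, rfl⟩ := Prod.mk.inj h
    refine ⟨⟨γ.1.mem, ?_⟩, hγ⟩
    change k⁻¹ • γ.1.val ∈ closure (ofN φ M '' (M : Set N))
    rw [← show γ.2.2.1 = k from hγ, γ.2.2.2]
    exact γ.2.1.mem
  · rintro ⟨⟨h1, h2⟩, rfl⟩
    exact ⟨⟨⟨y, h1⟩, ⟨g⁻¹ • y, h2⟩, ⟨g, rfl⟩⟩, rfl, rfl⟩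

theorem isClopen_elt_eq (k : N ⋊[φ] H) :
    IsClopen {γ : Arr (Mbar φ M) | γ.2.2.1 = k} := by
  let _ : TopologicalSpace (N ⋊[φ] H) := ⊥
  have : DiscreteTopology (N ⋊[φ] H) := ⟨rfl⟩
  have hc : Continuous fun γ : Arr (Mbar φ M) => γ.2.2.1 :=
    continuous_snd.comp (continuous_induced_dom
      (f := fun γ : Arr (Mbar φ M) => ((γ.1.val, γ.2.2.1) : Nbar φ M × (N ⋊[φ] H))))
  exact (isClopen_discrete {k}).preimage hc

/-- The indicator function of the set of arrows with group element `k`. -/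
def eltIndicator [CompactSpace (Mbar φ M)] (k : N ⋊[φ] H) :
    CompactlySupportedContinuousMap (Arr (Mbar φ M)) ℂ where
  toFun := Set.indicator {γ : Arr (Mbar φ M) | γ.2.2.1 = k} fun _ => 1
  continuous_toFun := (isClopen_elt_eq k).continuous_indicator continuous_const
  hasCompactSupport' := (isCompact_elt_eq hP k).of_isClosed_subset (isClosed_tsupport _)
    (closure_minimal Set.support_indicator_subset (isClopen_elt_eq k).1)

open Classical in
theorem eltIndicator_apply [CompactSpace (Mbar φ M)] (k : N ⋊[φ] H) (γ : Arr (Mbar φ M)) :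
    eltIndicator hP k γ = if γ.2.2.1 = k then 1 else 0 := by
  by_cases h : γ.2.2.1 = k
  · rw [if_pos h]
    exact Set.indicator_of_mem (s := {γ : Arr (Mbar φ M) | γ.2.2.1 = k}) h fun _ => (1 : ℂ)
  · rw [if_neg h]
    exact Set.indicator_of_notMem (s := {γ : Arr (Mbar φ M) | γ.2.2.1 = k}) h fun _ => (1 : ℂ)

theorem cornerRep_totalRegRep_eltIndicator [CompactSpace (Mbar φ M)] (k : N ⋊[φ] H) :
    cornerRep hP (totalRegRep (eltIndicator hP k)) = compress M k := by
  classical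
  refine op_ext fun p => ?_
  ext q
  have h2 : (pairElt φ M q * (pairElt φ M p)⁻¹)⁻¹ • ofN φ M q.1 = ofN φ M p.1 := by
    have h : ∀ p : M × H, ofN φ M (p.1 : N) = pairElt φ M p • ofN φ M 1 := fun p => by
      rw [smul_ofN]
      simp [pairElt]
    rw [h q, ← mul_smul, h p]
    congr 1
    group
  rw [cornerRep_totalRegRep_apply, compress_stdBasis_apply, kernel, dif_pos, eltIndicator_apply]
  · exact if_congr eq_comm rfl rfl
  · rw [h2]
    exact ⟨subset_closure ⟨q.1, q.1.2, rfl⟩, subset_closure ⟨p.1, p.1.2, rfl⟩⟩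

/-! ### Isometry, closed range and bijectivity -/

theorem norm_sub_le_norm_cornerRep_sub {T T' : RegularProduct (Mbar φ M)}
    (hT : T ∈ ReducedCStar (Mbar φ M)) (hT' : T' ∈ ReducedCStar (Mbar φ M)) :
    ‖T - T'‖ ≤ ‖cornerRep hP T - cornerRep hP T'‖ := by
  rw [← map_sub, norm_cornerRep]
  exact norm_le_of_mem_reducedCStar hP (sub_mem hT hT')

theorem isClosed_image_cornerRep :
    IsClosed (cornerRep hP '' (ReducedCStar (Mbar φ M) : Set (RegularProduct (Mbar φ M)))) := by
  have hcomplete : IsComplete (ReducedCStar (Mbar φ M) : Set (RegularProduct (Mbar φ M))) :=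
    IsClosed.isComplete isClosed_closure
  have : CompleteSpace (ReducedCStar (Mbar φ M) : Set (RegularProduct (Mbar φ M))) :=
    hcomplete.completeSpace_coe
  have hiso : Isometry fun T : (ReducedCStar (Mbar φ M) : Set (RegularProduct (Mbar φ M))) =>
      cornerRep hP T.1 := Isometry.of_dist_eq fun T T' => by
    rw [Subtype.dist_eq, dist_eq_norm, dist_eq_norm]
    refine le_antisymm ?_ (norm_sub_le_norm_cornerRep_sub hP T.2 T'.2)
    rw [← map_sub, norm_cornerRep]
    exact norm_evalHom_le _ _
  rw [Set.image_eq_range]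
  exact hiso.isClosedEmbedding.isClosed_range

theorem exists_cornerRep_eq [CompactSpace (Mbar φ M)] {A : Ell2 (M × H) →L[ℂ] Ell2 (M × H)}
    (hA : A ∈ RegularAlgebra φ M) : ∃ T ∈ ReducedCStar (Mbar φ M), cornerRep hP T = A := by
  have hmem : ∀ k : N ⋊[φ] H,
      compress M k ∈ (ReducedCStar (Mbar φ M)).map (cornerRep hP) := fun k =>
    ⟨_, subset_closure (NonUnitalStarAlgebra.subset_adjoin ℂ _ ⟨eltIndicator hP k, rfl⟩),
      cornerRep_totalRegRep_eltIndicator hP k⟩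
  -- The target is generated as a unital algebra and the source is treated as non-unital; the unit
  -- is recovered as the compression of the trivial translation.
  have hone : (1 : Ell2 (M × H) →L[ℂ] Ell2 (M × H))
      ∈ (ReducedCStar (Mbar φ M)).map (cornerRep hP) := by
    convert hmem 1
    exact op_ext fun p => (compress_stdBasis_of_eq (one_mul _)).symm
  have hle : StarAlgebra.adjoin ℂ (Set.range (S φ M) ∪ Set.range (U (H := H) M))
      ≤ ((ReducedCStar (Mbar φ M)).map (cornerRep hP)).toStarSubalgebra hone := by
    refine StarAlgebra.adjoin_le ?_
    rintro _ (⟨a, rfl⟩ | ⟨m, rfl⟩)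
    · rw [← compress_inr]
      exact hmem _
    · rw [← compress_inl (φ := φ)]
      exact hmem _
  exact closure_minimal (fun B hB => hle hB) (isClosed_image_cornerRep hP) hA

/-- The restriction of the regular representation at the identity to the reduced C*-algebra. -/
def reducedHom [CompactSpace (Mbar φ M)]
    (hP' : ∀ h : H, ∃ a ∈ P φ M, ∃ b ∈ P φ M, h = a⁻¹ * b) :
    ReducedCStar (Mbar φ M) →⋆ₙₐ[ℂ] RegularAlgebra φ M where
  toFun T := ⟨cornerRep hP T, cornerRep_mem hP hP' T.2⟩
  map_smul' c T := Subtype.ext (map_smul (cornerRep hP) c (T : RegularProduct (Mbar φ M)))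
  map_zero' := Subtype.ext (map_zero (cornerRep hP))
  map_add' T T' := Subtype.ext (map_add (cornerRep hP) (T : RegularProduct (Mbar φ M)) T')
  map_mul' T T' := Subtype.ext (map_mul (cornerRep hP) (T : RegularProduct (Mbar φ M)) T')
  map_star' T := Subtype.ext (map_star (cornerRep hP) (T : RegularProduct (Mbar φ M)))

theorem reducedHom_bijective [CompactSpace (Mbar φ M)]
    (hP' : ∀ h : H, ∃ a ∈ P φ M, ∃ b ∈ P φ M, h = a⁻¹ * b) :
    Function.Bijective (reducedHom hP hP') := by
  constructor
  · intro T T' h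
    have h1 : cornerRep hP T = cornerRep hP T' := congrArg Subtype.val h
    have h2 := norm_sub_le_norm_cornerRep_sub hP T.2 T'.2
    rw [h1, sub_self, norm_zero] at h2
    exact Subtype.ext (sub_eq_zero.1 (norm_le_zero_iff.1 h2))
  · rintro ⟨A, hA⟩
    obtain ⟨T, hT, rfl⟩ := exists_cornerRep_eq hP hA
    exact ⟨⟨T, hT⟩, rfl⟩

end Main

end CuntzLi

end

theorem mainTheorem8 {N H : Type*} [Group N] [Group H] (φ : H →* MulAut N)
    (M : Subgroup N) [M.Normal]
    (hC1 : ∀ h : H, ∃ a ∈ CuntzLi.P φ M, ∃ b ∈ CuntzLi.P φ M, h = a * b⁻¹)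
    (hC1' : ∀ h : H, ∃ a ∈ CuntzLi.P φ M, ∃ b ∈ CuntzLi.P φ M, h = a⁻¹ * b)
    (hC2 : ∀ a ∈ CuntzLi.P φ M, ((CuntzLi.conjSub φ M a).subgroupOf M).FiniteIndex)
    (hC3 : ⨅ a ∈ CuntzLi.P φ M, CuntzLi.conjSub φ M a = ⊥) :
    Nonempty (CuntzLi.ReducedCStar (CuntzLi.Mbar φ M) ≃⋆ₐ[ℂ] CuntzLi.RegularAlgebra φ M) := by
  have := CuntzLi.Mbar.compactSpace hC1 hC2
  exact ⟨StarAlgEquiv.ofBijective (CuntzLi.reducedHom hC1 hC1')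
    (CuntzLi.reducedHom_bijective hC1 hC1')⟩
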